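/- **Conventions.** Fix $r\in\{1,2,\dots\}\cup\{\infty\}$. Manifolds are finite-dimensional, $C^\infty$ and without boundary; products of metric spaces carry the maximum metric. *Laminations.* A $C^r$-lamination $\mathcal L$ of dimension $d$ is supported by a locally compact, second countable subset $L$ of a metric space. It is given by a maximal atlas of homeomorphisms (charts) $h_i:U_i\to V_i\times T_i$, where the $U_i$ are open in $L$ and cover $L$, $V_i\subset\mathbb R^d$ is open and $T_i$ is a metric space. The coordinate changes are required to be of the form $(x,t)\mapsto(\phi(x,t),\psi(x,t))$, where the derivatives $\partial_x^s\phi$, $s\le r$, exist and are continuous in $(x,t)$, and $\psi(\cdot,t)$ is locally constant. A *plaque* is a set $h_i^{-1}(V_i^0\times\{t\})$, where $h_i$ is a chart of the maximal atlas and $V_i^0$ a connected component of $V_i$. The *leaf* of $x$ is the smallest set that contains $x$ and every plaque it meets. A *$C^r$-morphism* of laminations is a continuous map that has, in charts, the form $(\phi,\psi)$ just described. It is an *immersion* if $\partial_x\phi$ is always injective. Immersions into manifolds are defined in the same way. The product charts generate the product lamination $\mathcal L\times\mathcal L'$. *Stratified spaces and trellises.* A *stratified space* $(A,\Sigma)$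 is a metric space $A$ with a locally finite partition $\Sigma$ into nonempty locally closed subsets (strata), each carrying a $C^r$-lamination structure, such that for $X,Y\in\Sigma$: if $X\cap\overline Y\neq\emptyset$ then $X\subset\overline Y$ (written $X\le Y$), and in this case $\dim X\le\dim Y$. The product $(A\times A',\Sigma\times\Sigma')$ has the strata $X\times X'$ with the product laminations. A *tubular neighborhood* of $X$ is a lamination $\mathcal L_X$ on an open neighborhood $L_X$ of $X$ with $L_X\subset\bigcup_{Y\ge X}Y$, such that the leaves of $X$ are leaves of $\mathcal L_X$ with the same $C^r$-structure, and such that for every stratum $Y\ne X$ and every $x\in L_X\cap Y$ some plaque of $\mathcal L_X$ containing $x$ is contained in a plaque of $Y$. A *trellis structure* is a family $\mathcal T=(L_X,\mathcal L_X)_{X\in\Sigma}$ of tubular neighborhoods such that, for $X\le Y$, $\mathcal L_X$ is a $C^r$-foliation of $\mathcal L_Y$ on $L_X\cap L_Y$: each point of $L_X\cap L_Y$ has a neighborhood $U$ with a homeomorphism $U\to U_1\times U_2\times T_2$, with $U_1\subset\mathbb R^{\dim X}$ and $U_2\subset\mathbb R^{\dim Y-\dim X}$ open, which is a chart of $\mathcal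 L_X$ (with transversal $U_2\times T_2$) and a chart of $\mathcal L_Y$ (with transversal $T_2$). *Controlled maps.* A *$\mathcal T$-controlled endomorphism* is a continuous map $f^*:A\to A$ that maps each stratum $X$ into itself as a $C^r$-morphism and such that every $X$ has an *adapted* neighborhood, that is, an open $V_X$ with $X\subset V_X\subset L_X$ such that $f^*|_{V_X}$ is a $C^r$-morphism from $\mathcal L_X|_{V_X}$ to $\mathcal L_X$. A *$\mathcal T$-controlled immersion* into a manifold $M$ is a continuous map $i:A\to M$ whose restriction to each stratum $X$, and to some neighborhood of $X$ in $L_X$ (with the lamination $\mathcal L_X$), is a $C^r$-immersion. It is an *embedding* if moreover it is a homeomorphism onto its image. *Pseudo-orbits.* For a positive function $\eta$, an *$\eta$-pseudo-orbit of $V$ which respects $\mathcal L$* is a sequence $(p_n)_{n\ge0}$ in $V$ such that, for each $n$, the points $f^*(p_n)$ and $p_{n+1}$ lie in a common plaque of $\mathcal L$ of diameter less than $\eta(p_{n+1})$. The map $f^*$ is *plaque-expansive* at a lamination $(L,\mathcal L)$ it preserves if for every continuous $\delta:L\to(0,\infty)$ there is a continuous $\varepsilon:L\to(0,\infty)$ with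 the following property: for every continuous $\eta$ with $0<\eta<\varepsilon$ and all $\eta$-pseudo-orbits $(x_n),(y_n)$ of $L$ which respect $\mathcal L$ and satisfy $d(x_n,y_n)<\eta(x_n)$ for all $n$, the points $x_0,y_0$ lie in a common plaque of diameter less than $\delta(x_0)$. If $i$ is an embedding and $f\circ i=i\circ f^*$, then $f$ is called plaque-expansive at a stratum $X$ if $f^*$ is plaque-expansive at the lamination $X$, with the metric of $A$. **Proposition.** Let $f:M\to M$ be a $C^r$-map of a manifold, $(A,\Sigma)$ a stratified space with a trellis structure $\mathcal T$, $i:A\to M$ a $\mathcal T$-controlled immersion and $f^*:A\to A$ a $\mathcal T$-controlled endomorphism such that (i) $f\circ i=i\circ f^*$; (iii) every stratum $X$ has an adapted neighborhood $V_X$ and a continuous positive function $\eta$ on $V_X$ such that every $\eta$-pseudo-orbit of $V_X$ which respects $\mathcal L_X$ is contained in $X$. Let $M'$, $f'$, $(A',\Sigma')$, $\mathcal T'$, $i'$, $f'^*$ satisfy the same hypotheses. Then there is a trellis structure $\mathcal T_{prod}$ on the product stratified space $(A\times A',\Sigma\times\Sigma')$ such that $(i,i'):A\times A'\to M\times M'$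 is a $\mathcal T_{prod}$-controlled immersion, $(f^*,f'^*)$ is a $\mathcal T_{prod}$-controlled endomorphism, and together with the $C^r$-map $(f,f')$ of $M\times M'$ they satisfy (i) and (iii). Moreover, if $i$ and $i'$ are embeddings, $f$ is plaque-expansive at each stratum of $\Sigma$ and $f'$ is plaque-expansive at each stratum of $\Sigma'$, then $(i,i')$ is an embedding and $(f,f')$ is plaque-expansive at each stratum of $\Sigma\times\Sigma'$. -/

import Mathlib

open Set Filter Topology
open scoped ENNReal ContDiff Manifold

universe u v w

/-! ## Leafwise regularity of maps defined on subsets of `ℝᵈ × T` -/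

section Leafwise

variable {E F T T' : Type*} [NormedAddCommGroup E] [NormedSpace ℝ E]
  [NormedAddCommGroup F] [NormedSpace ℝ F] [TopologicalSpace T]

/-- On `D ⊆ E × T` the partial derivatives `∂ₓˢ φ (x, t)`, `s ≤ r`, of `φ` with respect to the first
variable exist and are continuous functions of `(x, t)`. The sets `D` to which this is applied
have open slices `{x | (x, t) ∈ D}`, so that `p (x, t) s` is necessarily the `s`-th derivative. -/
def ContDiffLeafwiseOn (r : ℕ∞) (φ : E × T → F) (D : Set (E × T)) : Prop :=
  ∃ p : E × T → FormalMultilinearSeries ℝ E F,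
    (∀ t : T, HasFTaylorSeriesUpToOn (r : WithTop ℕ∞) (fun x => φ (x, t)) (fun x => p (x, t))
      {x | (x, t) ∈ D}) ∧
    ∀ s : ℕ, (s : ℕ∞) ≤ r → ContinuousOn (fun z => p z s) D

/-- For every `t` the map `ψ (·, t)` is locally constant on the slice `{x | (x, t) ∈ D}`. -/
def LocallyConstLeafwiseOn (ψ : E × T → T') (D : Set (E × T)) : Prop :=
  ∀ z ∈ D, ∀ᶠ x in 𝓝[{x | (x, z.2) ∈ D}] z.1, ψ (x, z.2) = ψ z

/-- A map `(x, t) ↦ (φ (x, t), ψ (x, t))` with `φ` of class `C^r` along the leaves and `ψ` constant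
along the leaves, locally. -/
def LeafwiseCr (r : ℕ∞) (g : E × T → F × T') (D : Set (E × T)) : Prop :=
  ContDiffLeafwiseOn r (fun z => (g z).1) D ∧ LocallyConstLeafwiseOn (fun z => (g z).2) D

end Leafwise

/-! ## Charts and laminations -/

/-- The `d`-dimensional Euclidean space. -/
abbrev Eucl (d : ℕ) : Type := EuclideanSpace ℝ (Fin d)

/-- A chart: a homeomorphism `h` from a subset `U` (the source) of a metric space `A` onto `V × T`,
where `V` is an open subset of `ℝᵈ` and `T` is a metric space. -/
structure LamChart (A : Type u) [MetricSpace A] (d : ℕ) : Type (u + 1) where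
  T : Type u
  metricT : MetricSpace T
  V : Set (Eucl d)
  isOpen_V : IsOpen V
  h : PartialHomeomorph A (Eucl d × T)
  target_eq : h.target = V ×ˢ univ

attribute [instance] LamChart.metricT

namespace LamChart

variable {A : Type u} [MetricSpace A] {d : ℕ}

/-- The domain on which the coordinate change `c'.h ∘ c.h⁻¹` is defined. -/
def overlap (c c' : LamChart A d) : Set (Eucl d × c.T) :=
  {z | z ∈ c.h.target ∧ c.h.symm z ∈ c'.h.source}

/-- The coordinate change `c'.h ∘ c.h⁻¹` has the form required of a lamination atlas. -/
def Compat (r : ℕ∞) (c c' : LamChart A d) : Prop :=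
  LeafwiseCr r (fun z => c'.h (c.h.symm z)) (c.overlap c')

end LamChart

/-- A `C^r`-lamination supported by a subset `carrier` of the metric space `A`, which carries the
topology and the metric induced by `A`. It is given by an atlas; the lamination structure is the
maximal atlas `Lamination.maxAtlas` that the atlas generates. -/
structure Lamination (r : ℕ∞) (A : Type u) [MetricSpace A] : Type (u + 1) where
  carrier : Set A
  locallyCompact : LocallyCompactSpace carrier
  secondCountable : SecondCountableTopology carrier
  dim : ℕ
  atlas : Set (LamChart A dim)
  source_open : ∀ c ∈ atlas, ∃ O : Set A, IsOpen O ∧ c.h.source = O ∩ carrier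
  cover : ∀ x ∈ carrier, ∃ c ∈ atlas, x ∈ c.h.source
  compat : ∀ c ∈ atlas, ∀ c' ∈ atlas, c.Compat r c'

namespace Lamination

variable {r : ℕ∞} {A : Type u} [MetricSpace A]

/-- The maximal atlas: all charts on relatively open subsets of the support that are compatible
with the charts of the atlas. -/
def maxAtlas (L : Lamination r A) : Set (LamChart A L.dim) :=
  {c | (∃ O : Set A, IsOpen O ∧ c.h.source = O ∩ L.carrier) ∧
    ∀ c' ∈ L.atlas, c.Compat r c' ∧ c'.Compat r c}

/-- A plaque: a set `h⁻¹ (V⁰ × {t})` for a chart `h : U → V × T` of the lamination, a connected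
component `V⁰` of `V` and a point `t` of `T`. -/
def IsPlaque (L : Lamination r A) (P : Set A) : Prop :=
  ∃ c ∈ L.maxAtlas, ∃ x ∈ c.V, ∃ t : c.T, P = c.h.symm '' (connectedComponentIn c.V x ×ˢ {t})

/-- The leaf of `x`: the smallest set that contains `x` and every plaque that it meets. -/
def leaf (L : Lamination r A) (x : A) : Set A :=
  ⋂₀ {S | x ∈ S ∧ ∀ P, L.IsPlaque P → (P ∩ S).Nonempty → P ⊆ S}

/-- Coherence of a lamination `L` with a lamination `L'` of at least the same dimension. -/
def Coherent (L L' : Lamination r A) : Prop :=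
  ∀ x ∈ L.carrier ∩ L'.carrier, ∃ P P', L.IsPlaque P ∧ L'.IsPlaque P' ∧ x ∈ P ∧ P ⊆ P'

/-- On the intersection of their supports (both open in `A` in all uses), `L` is a `C^r`-foliation
of `L'`: around every point there is a set which is the domain of a chart
`y ↦ (v, (u, t)) ∈ U₁ × (U₂ × T₂)` of `L` and of a chart `y ↦ ((v, u), t) ∈ (U₁ × U₂) × T₂` of `L'`,
where `ℝ^{d₁} × ℝᵏ` is identified with `ℝ^{d₂}`, `k = d₂ - d₁`. -/
def FoliatesOnInter (L L' : Lamination r A) : Prop :=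
  ∀ x ∈ L.carrier ∩ L'.carrier,
    ∃ c ∈ L.maxAtlas, ∃ c' ∈ L'.maxAtlas, x ∈ c.h.source ∧ c.h.source = c'.h.source ∧
      ∃ (k : ℕ) (κ : (Eucl L.dim × Eucl k) ≃L[ℝ] Eucl L'.dim) (U₂ : Set (Eucl k))
        (θ : c.T ≃ₜ U₂ × c'.T), IsOpen U₂ ∧
        ∀ y ∈ c.h.source,
          c'.h y = (κ ((c.h y).1, ((θ (c.h y).2).1 : Eucl k)), (θ (c.h y).2).2)

/-- The restriction of `f` to the relatively open subset `V` of `L` is a `C^r`-morphism of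
laminations from `L` restricted to `V` into `L'`. (By the chain rule this does not depend on the
choice of the atlases that generate the two maximal atlases.) -/
def IsMorphismOn {B : Type v} [MetricSpace B] (L : Lamination r A) (V : Set A)
    (L' : Lamination r B) (f : A → B) : Prop :=
  MapsTo f V L'.carrier ∧ ContinuousOn f V ∧
    ∀ c ∈ L.atlas, ∀ c' ∈ L'.atlas,
      LeafwiseCr r (fun z => c'.h (f (c.h.symm z)))
        {z | z ∈ c.h.target ∧ c.h.symm z ∈ V ∧ f (c.h.symm z) ∈ c'.h.source}

/-- The restriction of `f` to the relatively open subset `V` of `L` is a `C^r`-immersion of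
laminations from `L` restricted to `V` into `L'`. -/
def IsImmersionOn {B : Type v} [MetricSpace B] (L : Lamination r A) (V : Set A)
    (L' : Lamination r B) (f : A → B) : Prop :=
  L.IsMorphismOn V L' f ∧
    ∀ c ∈ L.atlas, ∀ c' ∈ L'.atlas, ∀ z ∈ c.h.target, c.h.symm z ∈ V →
      f (c.h.symm z) ∈ c'.h.source →
      Function.Injective (fderiv ℝ (fun x => (c'.h (f (c.h.symm (x, z.2)))).1) z.1)

/-- The restriction of `i` to the relatively open subset `V` of `L` is a `C^r`-immersion from the
lamination `L` restricted to `V` into the manifold `M`. -/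
def IsImmersionIntoManifoldOn {E H M : Type*} [NormedAddCommGroup E] [NormedSpace ℝ E]
    [TopologicalSpace H] (I : ModelWithCorners ℝ E H) [TopologicalSpace M] [ChartedSpace H M]
    (L : Lamination r A) (V : Set A) (i : A → M) : Prop :=
  ContinuousOn i V ∧
    ∀ c ∈ L.atlas, ∀ m : M,
      ContDiffLeafwiseOn r (fun z => extChartAt I m (i (c.h.symm z)))
        {z | z ∈ c.h.target ∧ c.h.symm z ∈ V ∧ i (c.h.symm z) ∈ (extChartAt I m).source} ∧
      ∀ z ∈ c.h.target, c.h.symm z ∈ V → i (c.h.symm z) ∈ (extChartAt I m).source →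
        Function.Injective (fderiv ℝ (fun x => extChartAt I m (i (c.h.symm (x, z.2)))) z.1)

/-- `p` is an `η`-pseudo-orbit of `V` under `f` which respects the lamination `L`. -/
def IsPseudoOrbit (L : Lamination r A) (V : Set A) (f : A → A) (η : A → ℝ) (p : ℕ → A) : Prop :=
  (∀ n, p n ∈ V) ∧ ∀ n, ∃ P, L.IsPlaque P ∧ f (p n) ∈ P ∧ p (n + 1) ∈ P ∧
    Metric.ediam P < ENNReal.ofReal (η (p (n + 1)))

/-- `f` is `ε`-plaque-expansive at `L`, where a plaque is small at `x` if its diameter is less than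
`δ x`. -/
def IsPlaqueExpansiveWith (L : Lamination r A) (f : A → A) (ε δ : A → ℝ) : Prop :=
  ∀ η : A → ℝ, ContinuousOn η L.carrier → (∀ x ∈ L.carrier, 0 < η x ∧ η x < ε x) →
    ∀ x y : ℕ → A, L.IsPseudoOrbit L.carrier f η x → L.IsPseudoOrbit L.carrier f η y →
      (∀ n, dist (x n) (y n) < η (x n)) →
      ∃ P, L.IsPlaque P ∧ x 0 ∈ P ∧ y 0 ∈ P ∧ Metric.ediam P < ENNReal.ofReal (δ (x 0))

/-- `f` is plaque-expansive at `L`: for every notion `δ` of smallness there is `ε` such that the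
initial points of any two pseudo-orbits that stay `ε`-close belong to a same small plaque. -/
def IsPlaqueExpansive (L : Lamination r A) (f : A → A) : Prop :=
  ∀ δ : A → ℝ, ContinuousOn δ L.carrier → (∀ x ∈ L.carrier, 0 < δ x) →
    ∃ ε : A → ℝ, ContinuousOn ε L.carrier ∧ (∀ x ∈ L.carrier, 0 < ε x) ∧
      L.IsPlaqueExpansiveWith f ε δ

end Lamination

/-! ## Stratified spaces and trellis structures -/

/-- A `C^r`-laminar stratification of the metric space `A`, with strata indexed by `ι`: a locally
finite partition of `A` into (nonempty) locally closed laminations with the frontier condition,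
such that incident strata have ordered dimensions. -/
structure LaminarStratification (r : ℕ∞) (A : Type u) [MetricSpace A] (ι : Type w) :
    Type (max (u + 1) w) where
  stratum : ι → Lamination r A
  nonempty : ∀ j, (stratum j).carrier.Nonempty
  disjoint : ∀ j k, j ≠ k → Disjoint (stratum j).carrier (stratum k).carrier
  cover : ⋃ j, (stratum j).carrier = univ
  locallyClosed : ∀ j, IsLocallyClosed (stratum j).carrier
  locallyFinite : LocallyFinite fun j => (stratum j).carrier
  frontier : ∀ j k, ((stratum j).carrier ∩ closure (stratum k).carrier).Nonempty →
    (stratum j).carrier ⊆ closure (stratum k).carrier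
  dim_le : ∀ j k, (stratum j).carrier ⊆ closure (stratum k).carrier →
    (stratum j).dim ≤ (stratum k).dim

namespace LaminarStratification

variable {r : ℕ∞} {A : Type u} [MetricSpace A] {ι : Type w}

/-- The order on the strata: `X ≤ Y` if `X` is contained in the closure of `Y`. -/
def Le (S : LaminarStratification r A ι) (j k : ι) : Prop :=
  (S.stratum j).carrier ⊆ closure (S.stratum k).carrier

/-- `N` is a tubular neighborhood of the `j`-th stratum `X`. That the leaves of `X` (with their
`C^r`-structure) are leaves of `N` is expressed by the equality of the dimensions, the equality of
the leaves as sets, and the fact that the inclusion of `X` into `N` is a `C^r`-immersion. -/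
structure IsTubularNeighborhood (S : LaminarStratification r A ι) (j : ι) (N : Lamination r A) :
    Prop where
  isOpen : IsOpen N.carrier
  subset : (S.stratum j).carrier ⊆ N.carrier
  incident : ∀ x ∈ N.carrier, ∃ k, S.Le j k ∧ x ∈ (S.stratum k).carrier
  dim_eq : N.dim = (S.stratum j).dim
  leaf_eq : ∀ x ∈ (S.stratum j).carrier, (S.stratum j).leaf x = N.leaf x
  inclusion : (S.stratum j).IsImmersionOn (S.stratum j).carrier N id
  coherent : ∀ k, k ≠ j → N.Coherent (S.stratum k)

/-- A `C^r`-trellis structure on a stratified space. -/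
structure Trellis (S : LaminarStratification r A ι) : Type (max (u + 1) w) where
  nhd : ι → Lamination r A
  tubular : ∀ j, S.IsTubularNeighborhood j (nhd j)
  foliates : ∀ j k, S.Le j k → (nhd j).FoliatesOnInter (nhd k)

namespace Trellis

variable {S : LaminarStratification r A ι}

/-- `V` is a neighborhood of the `j`-th stratum adapted to the endomorphism `f`. -/
def IsAdapted (T : Trellis S) (f : A → A) (j : ι) (V : Set A) : Prop :=
  IsOpen V ∧ (S.stratum j).carrier ⊆ V ∧ V ⊆ (T.nhd j).carrier ∧
    (T.nhd j).IsMorphismOn V (T.nhd j) f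

/-- `f` is a controlled `C^r`-endomorphism: a continuous map that preserves each stratum, is a
`C^r`-morphism on it, and has an adapted neighborhood of it. -/
def IsControlledEndomorphism (T : Trellis S) (f : A → A) : Prop :=
  Continuous f ∧ ∀ j, (S.stratum j).IsMorphismOn (S.stratum j).carrier (S.stratum j) f ∧
    ∃ V, T.IsAdapted f j V

/-- `i` is a controlled `C^r`-immersion into the manifold `M`: a continuous map whose restriction
to each stratum, and to a neighborhood of the stratum in its tubular neighborhood, is a
`C^r`-immersion of laminations. -/
def IsControlledImmersion {E H M : Type*} [NormedAddCommGroup E] [NormedSpace ℝ E]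
    [TopologicalSpace H] (I : ModelWithCorners ℝ E H) [TopologicalSpace M] [ChartedSpace H M]
    (T : Trellis S) (i : A → M) : Prop :=
  Continuous i ∧ ∀ j, (S.stratum j).IsImmersionIntoManifoldOn I (S.stratum j).carrier i ∧
    ∃ V, IsOpen V ∧ (S.stratum j).carrier ⊆ V ∧ V ⊆ (T.nhd j).carrier ∧
      (T.nhd j).IsImmersionIntoManifoldOn I V i

/-- Every stratum `X` has an adapted neighborhood `V` and a continuous positive function `η` on `V`
such that each `η`-pseudo-orbit of `V` which respects the tubular lamination is contained
in `X`. -/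
def PseudoOrbitsInStrata (T : Trellis S) (f : A → A) : Prop :=
  ∀ j, ∃ V, T.IsAdapted f j V ∧ ∃ η : A → ℝ, ContinuousOn η V ∧ (∀ x ∈ V, 0 < η x) ∧
    ∀ p : ℕ → A, (T.nhd j).IsPseudoOrbit V f η p → ∀ n, p n ∈ (S.stratum j).carrier

end Trellis

end LaminarStratification

/-! ## Products -/

section ProductLeafwise

variable {E₁ E₂ E F₁ F₂ F T₁ T₂ T₁' T₂' : Type*}
  [NormedAddCommGroup E₁] [NormedSpace ℝ E₁] [NormedAddCommGroup E₂] [NormedSpace ℝ E₂]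
  [NormedAddCommGroup E] [NormedSpace ℝ E]
  [NormedAddCommGroup F₁] [NormedSpace ℝ F₁] [NormedAddCommGroup F₂] [NormedSpace ℝ F₂]
  [NormedAddCommGroup F] [NormedSpace ℝ F]
  [TopologicalSpace T₁] [TopologicalSpace T₂]

/-- The product of two leafwise `C^r` maps is leafwise `C^r`. -/
theorem LeafwiseCr.prod {r : ℕ∞} (κ : E ≃L[ℝ] E₁ × E₂) (μ : (F₁ × F₂) ≃L[ℝ] F)
    {g₁ : E₁ × T₁ → F₁ × T₁'} {g₂ : E₂ × T₂ → F₂ × T₂'}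
    {D₁ : Set (E₁ × T₁)} {D₂ : Set (E₂ × T₂)}
    (h₁ : LeafwiseCr r g₁ D₁) (h₂ : LeafwiseCr r g₂ D₂)
    {g : E × (T₁ × T₂) → F × (T₁' × T₂')} {D : Set (E × (T₁ × T₂))}
    (hD₁ : ∀ z ∈ D, ((κ z.1).1, z.2.1) ∈ D₁) (hD₂ : ∀ z ∈ D, ((κ z.1).2, z.2.2) ∈ D₂)
    (hg : ∀ z ∈ D, g z = (μ ((g₁ ((κ z.1).1, z.2.1)).1, (g₂ ((κ z.1).2, z.2.2)).1),
      ((g₁ ((κ z.1).1, z.2.1)).2, (g₂ ((κ z.1).2, z.2.2)).2))) :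
    LeafwiseCr r g D := by
  obtain ⟨⟨p₁, hp₁, hc₁⟩, hl₁⟩ := h₁
  obtain ⟨⟨p₂, hp₂, hc₂⟩, hl₂⟩ := h₂
  let a₁ : E →L[ℝ] E₁ := (ContinuousLinearMap.fst ℝ E₁ E₂).comp (κ : E →L[ℝ] E₁ × E₂)
  let a₂ : E →L[ℝ] E₂ := (ContinuousLinearMap.snd ℝ E₁ E₂).comp (κ : E →L[ℝ] E₁ × E₂)
  have ht₁ : ContinuousOn (fun z : E × (T₁ × T₂) => ((κ z.1).1, z.2.1)) D := by fun_prop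
  have ht₂ : ContinuousOn (fun z : E × (T₁ × T₂) => ((κ z.1).2, z.2.2)) D := by fun_prop
  refine ⟨⟨fun z k => (μ : F₁ × F₂ →L[ℝ] F).compContinuousMultilinearMap
    (((p₁ ((κ z.1).1, z.2.1) k).compContinuousLinearMap fun _ => a₁).prod
      ((p₂ ((κ z.1).2, z.2.2) k).compContinuousLinearMap fun _ => a₂)), ?_, ?_⟩, ?_⟩
  · rintro ⟨t₁, t₂⟩
    have q₁ := ((hp₁ t₁).compContinuousLinearMap a₁).mono
      (t := {x | (x, (t₁, t₂)) ∈ D}) (fun x hx => hD₁ _ hx)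
    have q₂ := ((hp₂ t₂).compContinuousLinearMap a₂).mono
      (t := {x | (x, (t₁, t₂)) ∈ D}) (fun x hx => hD₂ _ hx)
    refine ((q₁.prodMk q₂).continuousLinearMap_comp (μ : F₁ × F₂ →L[ℝ] F)).congr ?_
    intro x hx
    exact congrArg Prod.fst (hg _ hx)
  · intro s hs
    have k₁ : ContinuousOn (fun z : E × (T₁ × T₂) =>
        (p₁ ((κ z.1).1, z.2.1) s).compContinuousLinearMap fun _ => a₁) D :=
      (ContinuousMultilinearMap.compContinuousLinearMapL (F := F₁)
        fun _ : Fin s => a₁).continuous.comp_continuousOn ((hc₁ s hs).comp ht₁ hD₁)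
    have k₂ : ContinuousOn (fun z : E × (T₁ × T₂) =>
        (p₂ ((κ z.1).2, z.2.2) s).compContinuousLinearMap fun _ => a₂) D :=
      (ContinuousMultilinearMap.compContinuousLinearMapL (F := F₂)
        fun _ : Fin s => a₂).continuous.comp_continuousOn ((hc₂ s hs).comp ht₂ hD₂)
    exact (ContinuousLinearMap.compContinuousMultilinearMapL ℝ (fun _ : Fin s => E) (F₁ × F₂) F
      (μ : F₁ × F₂ →L[ℝ] F)).continuous.comp_continuousOn
        ((ContinuousMultilinearMap.prodL ℝ (fun _ : Fin s => E) F₁ F₂).continuous.comp_continuousOn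
          (k₁.prodMk k₂))
  · rintro ⟨x, t₁, t₂⟩ hz
    have c₁ : Tendsto (fun y : E => (κ y).1) (𝓝[{y | (y, (t₁, t₂)) ∈ D}] x)
        (𝓝[{y | (y, t₁) ∈ D₁}] (κ x).1) :=
      tendsto_nhdsWithin_iff.2 ⟨(a₁.continuous.tendsto x).mono_left nhdsWithin_le_nhds,
        eventually_mem_nhdsWithin.mono fun y hy => hD₁ _ hy⟩
    have c₂ : Tendsto (fun y : E => (κ y).2) (𝓝[{y | (y, (t₁, t₂)) ∈ D}] x)
        (𝓝[{y | (y, t₂) ∈ D₂}] (κ x).2) :=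
      tendsto_nhdsWithin_iff.2 ⟨(a₂.continuous.tendsto x).mono_left nhdsWithin_le_nhds,
        eventually_mem_nhdsWithin.mono fun y hy => hD₂ _ hy⟩
    filter_upwards [c₁.eventually (hl₁ _ (hD₁ _ hz)), c₂.eventually (hl₂ _ (hD₂ _ hz)),
      eventually_mem_nhdsWithin] with y e₁ e₂ hy
    have hy' := hg _ hy
    have hz' := hg _ hz
    simp only at e₁ e₂ hy' hz' ⊢
    rw [hy', hz', e₁, e₂]

end ProductLeafwise

/-- The identification of `ℝ^{m + n}` with `ℝᵐ × ℝⁿ`. -/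
noncomputable abbrev euclAdd (m n : ℕ) : Eucl (m + n) ≃L[ℝ] Eucl m × Eucl n :=
  EuclideanSpace.finAddEquivProd

/-- The product chart `(a, a') ↦ ((x, x'), (t, t'))` of the charts `a ↦ (x, t)` and
`a' ↦ (x', t')`. -/
noncomputable def LamChart.prod {A : Type u} {A' : Type v} [MetricSpace A] [MetricSpace A']
    {d d' : ℕ} (c : LamChart A d) (c' : LamChart A' d') : LamChart (A × A') (d + d') where
  T := c.T × c'.T
  metricT := inferInstance
  V := euclAdd d d' ⁻¹' (c.V ×ˢ c'.V)
  isOpen_V := (c.isOpen_V.prod c'.isOpen_V).preimage (euclAdd d d').continuous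
  h :=
    { toFun := fun a => ((euclAdd d d').symm ((c.h a.1).1, (c'.h a.2).1),
        ((c.h a.1).2, (c'.h a.2).2))
      invFun := fun z => (c.h.symm ((euclAdd d d' z.1).1, z.2.1),
        c'.h.symm ((euclAdd d d' z.1).2, z.2.2))
      source := c.h.source ×ˢ c'.h.source
      target := (euclAdd d d' ⁻¹' (c.V ×ˢ c'.V)) ×ˢ univ
      map_source' := by
        rintro ⟨a, a'⟩ ⟨ha, ha'⟩
        have h1 := c.h.map_source ha
        have h2 := c'.h.map_source ha'
        rw [c.target_eq] at h1
        rw [c'.target_eq] at h2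
        simpa using ⟨h1.1, h2.1⟩
      map_target' := by
        rintro ⟨x, t, t'⟩ ⟨hx, -⟩
        exact ⟨c.h.map_target (by rw [c.target_eq]; exact ⟨hx.1, mem_univ _⟩),
          c'.h.map_target (by rw [c'.target_eq]; exact ⟨hx.2, mem_univ _⟩)⟩
      left_inv' := by
        rintro ⟨a, a'⟩ ⟨ha, ha'⟩
        simp only [ContinuousLinearEquiv.apply_symm_apply, Prod.mk.eta]
        rw [c.h.left_inv ha, c'.h.left_inv ha']
      right_inv' := by
        rintro ⟨x, t, t'⟩ ⟨hx, -⟩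
        have h1 : ((euclAdd d d' x).1, t) ∈ c.h.target := by
          rw [c.target_eq]; exact ⟨hx.1, mem_univ _⟩
        have h2 : ((euclAdd d d' x).2, t') ∈ c'.h.target := by
          rw [c'.target_eq]; exact ⟨hx.2, mem_univ _⟩
        simp only
        rw [c.h.right_inv h1, c'.h.right_inv h2]
        exact Prod.ext ((euclAdd d d').symm_apply_apply x) rfl
      continuousOn_toFun := by
        have h1 : ContinuousOn (fun a : A × A' => c.h a.1) (c.h.source ×ˢ c'.h.source) :=
          c.h.continuousOn.comp continuousOn_fst fun a ha => ha.1
        have h2 : ContinuousOn (fun a : A × A' => c'.h a.2) (c.h.source ×ˢ c'.h.source) :=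
          c'.h.continuousOn.comp continuousOn_snd fun a ha => ha.2
        exact ((euclAdd d d').symm.continuous.comp_continuousOn (h1.fst.prodMk h2.fst)).prodMk
          (h1.snd.prodMk h2.snd)
      continuousOn_invFun := by
        refine ContinuousOn.prodMk (c.h.continuousOn_symm.comp (by fun_prop) ?_)
          (c'.h.continuousOn_symm.comp (by fun_prop) ?_)
        · rintro ⟨x, t, t'⟩ ⟨hx, -⟩
          rw [c.target_eq]; exact ⟨hx.1, mem_univ _⟩
        · rintro ⟨x, t, t'⟩ ⟨hx, -⟩
          rw [c'.target_eq]; exact ⟨hx.2, mem_univ _⟩ }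
  target_eq := rfl

/-- Products of compatible charts are compatible. -/
theorem LamChart.Compat.prod {r : ℕ∞} {A : Type u} {A' : Type v} [MetricSpace A] [MetricSpace A']
    {d d' : ℕ} {c₁ c₂ : LamChart A d} {c₁' c₂' : LamChart A' d'}
    (h : c₁.Compat r c₂) (h' : c₁'.Compat r c₂') : (c₁.prod c₁').Compat r (c₂.prod c₂') := by
  refine LeafwiseCr.prod (euclAdd d d') (euclAdd d d').symm h h' ?_ ?_ fun z _ => rfl
  · rintro ⟨x, t, t'⟩ ⟨⟨hx, -⟩, hs⟩
    exact ⟨by rw [c₁.target_eq]; exact ⟨hx.1, mem_univ _⟩, hs.1⟩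
  · rintro ⟨x, t, t'⟩ ⟨⟨hx, -⟩, hs⟩
    exact ⟨by rw [c₁'.target_eq]; exact ⟨hx.2, mem_univ _⟩, hs.2⟩

/-- The product of two laminations, generated by the product charts; its leaves are the products
of the leaves. The product `A × A'` carries the maximum metric. -/
noncomputable def Lamination.prod {r : ℕ∞} {A : Type u} {A' : Type v} [MetricSpace A]
    [MetricSpace A'] (L : Lamination r A) (L' : Lamination r A') : Lamination r (A × A') where
  carrier := L.carrier ×ˢ L'.carrier
  locallyCompact := by
    have := L.locallyCompact
    have := L'.locallyCompact
    exact (Homeomorph.Set.prod L.carrier L'.carrier).isClosedEmbedding.locallyCompactSpace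
  secondCountable := by
    have := L.secondCountable
    have := L'.secondCountable
    exact (Homeomorph.Set.prod L.carrier L'.carrier).secondCountableTopology
  dim := L.dim + L'.dim
  atlas := {b | ∃ c ∈ L.atlas, ∃ c' ∈ L'.atlas, b = c.prod c'}
  source_open := by
    rintro _ ⟨c, hc, c', hc', rfl⟩
    obtain ⟨O, hO, h⟩ := L.source_open c hc
    obtain ⟨O', hO', h'⟩ := L'.source_open c' hc'
    refine ⟨O ×ˢ O', hO.prod hO', ?_⟩
    change c.h.source ×ˢ c'.h.source = _
    rw [h, h', prod_inter_prod]
  cover := by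
    rintro ⟨a, a'⟩ ⟨ha, ha'⟩
    obtain ⟨c, hc, h⟩ := L.cover a ha
    obtain ⟨c', hc', h'⟩ := L'.cover a' ha'
    exact ⟨c.prod c', ⟨c, hc, c', hc', rfl⟩, h, h'⟩
  compat := by
    rintro _ ⟨c₁, h₁, c₁', h₁', rfl⟩ _ ⟨c₂, h₂, c₂', h₂', rfl⟩
    exact (L.compat c₁ h₁ c₂ h₂).prod (L'.compat c₁' h₁' c₂' h₂')

/-- The product stratified space: its strata are the products of the strata. -/
noncomputable def LaminarStratification.prod {r : ℕ∞} {A : Type u} {A' : Type v} [MetricSpace A]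
    [MetricSpace A'] {ι : Type*} {ι' : Type*} (S : LaminarStratification r A ι)
    (S' : LaminarStratification r A' ι') : LaminarStratification r (A × A') (ι × ι') where
  stratum j := (S.stratum j.1).prod (S'.stratum j.2)
  nonempty j := (S.nonempty j.1).prod (S'.nonempty j.2)
  disjoint := by
    rintro ⟨j, j'⟩ ⟨k, k'⟩ hjk
    refine disjoint_prod.2 ?_
    by_cases h : j = k
    · refine Or.inr (S'.disjoint _ _ fun h' => hjk ?_)
      simp_all
    · exact Or.inl (S.disjoint _ _ h)
  cover := by
    refine eq_univ_of_forall fun a => ?_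
    obtain ⟨j, hj⟩ := mem_iUnion.1 (S.cover.symm ▸ mem_univ a.1)
    obtain ⟨j', hj'⟩ := mem_iUnion.1 (S'.cover.symm ▸ mem_univ a.2)
    exact mem_iUnion.2 ⟨(j, j'), hj, hj'⟩
  locallyClosed j :=
    ((S.locallyClosed j.1).preimage continuous_fst).inter
      ((S'.locallyClosed j.2).preimage continuous_snd)
  locallyFinite := by
    intro a
    obtain ⟨U, hU, hf⟩ := S.locallyFinite a.1
    obtain ⟨U', hU', hf'⟩ := S'.locallyFinite a.2
    refine ⟨U ×ˢ U', prod_mem_nhds hU hU', (hf.prod hf').subset ?_⟩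
    rintro ⟨j, j'⟩ ⟨x, hx, hxU⟩
    exact ⟨⟨x.1, hx.1, hxU.1⟩, ⟨x.2, hx.2, hxU.2⟩⟩
  frontier := by
    rintro ⟨j, j'⟩ ⟨k, k'⟩ ⟨x, hx, hxk⟩
    change _ ∈ closure (_ ×ˢ _) at hxk
    change _ ×ˢ _ ⊆ closure (_ ×ˢ _)
    rw [closure_prod_eq] at hxk ⊢
    exact prod_mono (S.frontier j k ⟨x.1, hx.1, hxk.1⟩) (S'.frontier j' k' ⟨x.2, hx.2, hxk.2⟩)
  dim_le := by
    rintro ⟨j, j'⟩ ⟨k, k'⟩ h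
    change _ ×ˢ _ ⊆ closure (_ ×ˢ _) at h
    rw [closure_prod_eq] at h
    obtain ⟨x, hx⟩ := S.nonempty j
    obtain ⟨x', hx'⟩ := S'.nonempty j'
    have hk := h (show (x, x') ∈ _ from ⟨hx, hx'⟩)
    exact add_le_add (S.dim_le j k (S.frontier j k ⟨x, hx, hk.1⟩))
      (S'.dim_le j' k' (S'.frontier j' k' ⟨x', hx', hk.2⟩))

/-! ## Products of leafwise regular maps -/

section FDeriv

variable {E₁ E₂ E F₁ F₂ F : Type*}
  [NormedAddCommGroup E₁] [NormedSpace ℝ E₁] [NormedAddCommGroup E₂] [NormedSpace ℝ E₂]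
  [NormedAddCommGroup E] [NormedSpace ℝ E]
  [NormedAddCommGroup F₁] [NormedSpace ℝ F₁] [NormedAddCommGroup F₂] [NormedSpace ℝ F₂]
  [NormedAddCommGroup F] [NormedSpace ℝ F]

/-! The tubular neighborhoods of the product trellis are the products of the given ones. Regularity,
immersivity and the foliation condition are local and are checked in product charts, where maps and
derivatives split into pairs.

The difficulty is that plaques come from the maximal atlas. A product of plaques is a plaque
(`IsPlaque.prod`), but a plaque of the product lamination need not be a product, and its projections
need not be plaques. Plaques are therefore relaxed to leafwise connected sets
(`IsLeafwiseConnected`), a class that contains the plaques and is stable under projection. Inside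
one chart domain such a set has constant transversal coordinate (`snd_eq`), so a small one lies in a
small plaque (`exists_refinesPlaques`). Hence pseudo-orbits of the product with fine enough control
project to pseudo-orbits of the factors (`IsPseudoOrbit.fst`, `IsPseudoOrbit.snd`), which gives
(iii). The same notion shows that leaves of the product are products of leaves (`leaf_prod`).

Coherence needs one more fact. If X × Y' differs from X × X', the product must be coherent with it,
so the tubular lamination of X must be coherent with X itself. This follows from the inverse
function theorem, because the inclusion is an immersion between laminations of equal dimension
(`IsImmersionOn.coherent`).

For plaque-expansiveness, the required size `δ` depends on both coordinates and cannot be handed to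
the factors. They are asked only for a common plaque small enough to lie in a chart domain; two
points of such a plaque that are also close lie in a plaque as small as desired
(`exists_common_small_plaque`). All size functions are first chosen locally and then glued
(`exists_continuousOn_pos_of_local`). -/

/-- The default value 0 of `fderiv` is injective only on a trivial space, where every map is
differentiable. So the injectivity conditions in the immersion definitions already contain
differentiability. -/
theorem differentiableAt_of_injective_fderiv {f : E → F} {x : E}
    (h : Function.Injective (fderiv ℝ f x)) : DifferentiableAt ℝ f x := by
  by_contra hd
  rw [fderiv_zero_of_not_differentiableAt hd] at h
  have : Subsingleton E := ⟨fun a b => h rfl⟩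
  exact hd (hasFDerivAt_of_subsingleton f x).differentiableAt

theorem injective_fderiv_prod (κ : E ≃L[ℝ] E₁ × E₂) (μ : (F₁ × F₂) ≃L[ℝ] F)
    {g₁ : E₁ → F₁} {g₂ : E₂ → F₂} {x : E}
    (h₁ : Function.Injective (fderiv ℝ g₁ (κ x).1))
    (h₂ : Function.Injective (fderiv ℝ g₂ (κ x).2)) :
    Function.Injective (fderiv ℝ (fun y => μ (g₁ (κ y).1, g₂ (κ y).2)) x) := by
  have d₁ := (differentiableAt_of_injective_fderiv h₁).hasFDerivAt
  have d₂ := (differentiableAt_of_injective_fderiv h₂).hasFDerivAt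
  have k : HasFDerivAt (fun y => κ y) (κ : E →L[ℝ] E₁ × E₂) x := κ.hasFDerivAt
  have e₁ := HasFDerivAt.comp x (f := fun y => (κ y).1) d₁ k.fst
  have e₂ := HasFDerivAt.comp x (f := fun y => (κ y).2) d₂ k.snd
  have e := HasFDerivAt.comp x (f := fun y => (g₁ (κ y).1, g₂ (κ y).2))
    μ.hasFDerivAt (e₁.prodMk e₂)
  have e' : HasFDerivAt (fun y => μ (g₁ (κ y).1, g₂ (κ y).2)) _ x := e
  rw [e'.fderiv]
  intro a b hab
  have hab' := μ.injective hab
  exact κ.injective (Prod.ext (h₁ (congrArg Prod.fst hab')) (h₂ (congrArg Prod.snd hab')))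

theorem ContDiffLeafwiseOn.prod {T₁ T₂ : Type*} [TopologicalSpace T₁] [TopologicalSpace T₂]
    {r : ℕ∞} (κ : E ≃L[ℝ] E₁ × E₂) {g₁ : E₁ × T₁ → F₁} {g₂ : E₂ × T₂ → F₂}
    {D₁ : Set (E₁ × T₁)} {D₂ : Set (E₂ × T₂)}
    (h₁ : ContDiffLeafwiseOn r g₁ D₁) (h₂ : ContDiffLeafwiseOn r g₂ D₂)
    {D : Set (E × (T₁ × T₂))}
    (hD₁ : ∀ z ∈ D, ((κ z.1).1, z.2.1) ∈ D₁) (hD₂ : ∀ z ∈ D, ((κ z.1).2, z.2.2) ∈ D₂) :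
    ContDiffLeafwiseOn r (fun z => (g₁ ((κ z.1).1, z.2.1), g₂ ((κ z.1).2, z.2.2))) D := by
  -- One-point transversals in the target make the locally constant part vacuous.
  have l₁ : LeafwiseCr r (fun z => (g₁ z, ())) D₁ := ⟨h₁, fun _ _ => Eventually.of_forall fun _ => rfl⟩
  have l₂ : LeafwiseCr r (fun z => (g₂ z, ())) D₂ := ⟨h₂, fun _ _ => Eventually.of_forall fun _ => rfl⟩
  exact (LeafwiseCr.prod (g := fun z => ((g₁ ((κ z.1).1, z.2.1), g₂ ((κ z.1).2, z.2.2)), ((), ())))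
    κ (ContinuousLinearEquiv.refl ℝ (F₁ × F₂)) l₁ l₂ hD₁ hD₂ fun _ _ => rfl).1

end FDeriv

theorem LeafwiseCr.mono {E F T T' : Type*} [NormedAddCommGroup E] [NormedSpace ℝ E]
    [NormedAddCommGroup F] [NormedSpace ℝ F] [TopologicalSpace T] {r : ℕ∞}
    {g : E × T → F × T'} {D D' : Set (E × T)} (h : LeafwiseCr r g D) (hD : D' ⊆ D) :
    LeafwiseCr r g D' := by
  obtain ⟨⟨p, hp, hc⟩, hl⟩ := h
  exact ⟨⟨p, fun t => (hp t).mono fun x hx => hD hx, fun s hs => (hc s hs).mono hD⟩,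
    fun z hz => (hl z (hD hz)).filter_mono
      (nhdsWithin_mono z.1 (show {x | (x, z.2) ∈ D'} ⊆ {x | (x, z.2) ∈ D} from fun x hx => hD hx))⟩

theorem connectedComponentIn_prod {X Y : Type*} [TopologicalSpace X] [TopologicalSpace Y]
    {s : Set X} {t : Set Y} {x : X} {y : Y} (hx : x ∈ s) (hy : y ∈ t) :
    connectedComponentIn (s ×ˢ t) (x, y) = connectedComponentIn s x ×ˢ connectedComponentIn t y := by
  apply Subset.antisymm
  · have h := isPreconnected_connectedComponentIn (F := s ×ˢ t) (x := (x, y))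
    have hm : (x, y) ∈ connectedComponentIn (s ×ˢ t) (x, y) := mem_connectedComponentIn ⟨hx, hy⟩
    have hs := connectedComponentIn_subset (s ×ˢ t) (x, y)
    refine fun z hz => ⟨?_, ?_⟩
    · refine (h.image Prod.fst continuousOn_fst).subset_connectedComponentIn ⟨_, hm, rfl⟩ ?_
        ⟨z, hz, rfl⟩
      rintro _ ⟨w, hw, rfl⟩
      exact (hs hw).1
    · refine (h.image Prod.snd continuousOn_snd).subset_connectedComponentIn ⟨_, hm, rfl⟩ ?_
        ⟨z, hz, rfl⟩
      rintro _ ⟨w, hw, rfl⟩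
      exact (hs hw).2
  · exact (isPreconnected_connectedComponentIn.prod
      isPreconnected_connectedComponentIn).subset_connectedComponentIn
      ⟨mem_connectedComponentIn hx, mem_connectedComponentIn hy⟩
      (prod_mono (connectedComponentIn_subset _ _) (connectedComponentIn_subset _ _))

/-! ## Charts and plaques -/

/-- The restriction of a chart to the points whose leaf coordinate is in the open set `W`. -/
def LamChart.restrict {A : Type u} [MetricSpace A] {d : ℕ} (c : LamChart A d) (W : Set (Eucl d))
    (hW : IsOpen W) (hWV : W ⊆ c.V) : LamChart A d where
  T := c.T
  metricT := c.metricT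
  V := W
  isOpen_V := hW
  h :=
    { toFun := c.h
      invFun := c.h.symm
      source := {a | a ∈ c.h.source ∧ (c.h a).1 ∈ W}
      target := W ×ˢ univ
      map_source' := fun a ha => ⟨ha.2, mem_univ _⟩
      map_target' := by
        intro z hz
        have hz' : z ∈ c.h.target := by rw [c.target_eq]; exact ⟨hWV hz.1, mem_univ _⟩
        refine ⟨c.h.map_target hz', ?_⟩
        rw [c.h.right_inv hz']
        exact hz.1
      left_inv' := fun a ha => c.h.left_inv ha.1
      right_inv' := fun z hz => c.h.right_inv (by rw [c.target_eq]; exact ⟨hWV hz.1, mem_univ _⟩)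
      continuousOn_toFun := c.h.continuousOn.mono fun a ha => ha.1
      continuousOn_invFun := c.h.continuousOn_symm.mono fun z hz => by
        rw [c.target_eq]; exact ⟨hWV hz.1, mem_univ _⟩ }
  target_eq := rfl

theorem LamChart.mem_target {A : Type u} [MetricSpace A] {d : ℕ} (c : LamChart A d)
    {z : Eucl d × c.T} : z ∈ c.h.target ↔ z.1 ∈ c.V := by
  rw [c.target_eq]
  simp

namespace Lamination

variable {r : ℕ∞} {A : Type u} [MetricSpace A] (L : Lamination r A)

theorem atlas_subset_maxAtlas : L.atlas ⊆ L.maxAtlas := fun c hc =>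
  ⟨L.source_open c hc, fun c' hc' => ⟨L.compat c hc c' hc', L.compat c' hc' c hc⟩⟩

variable {L}

theorem source_subset {c : LamChart A L.dim} (hc : c ∈ L.maxAtlas) : c.h.source ⊆ L.carrier := by
  obtain ⟨O, -, h⟩ := hc.1
  rw [h]
  exact inter_subset_right

theorem source_mem_nhdsWithin {c : LamChart A L.dim} (hc : c ∈ L.maxAtlas) {a : A}
    (ha : a ∈ c.h.source) : c.h.source ∈ 𝓝[L.carrier] a := by
  obtain ⟨O, hO, h⟩ := hc.1
  rw [h] at ha ⊢
  rw [inter_comm]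
  exact inter_mem_nhdsWithin _ (hO.mem_nhds ha.1)

theorem continuousWithinAt_chart {c : LamChart A L.dim} (hc : c ∈ L.maxAtlas) {a : A}
    (ha : a ∈ c.h.source) : ContinuousWithinAt c.h L.carrier a :=
  (c.h.continuousOn a ha).mono_of_mem_nhdsWithin (source_mem_nhdsWithin hc ha)

theorem restrict_mem_maxAtlas {c : LamChart A L.dim} (hc : c ∈ L.maxAtlas)
    {W : Set (Eucl L.dim)} (hW : IsOpen W) (hWV : W ⊆ c.V) :
    c.restrict W hW hWV ∈ L.maxAtlas := by
  refine ⟨?_, fun c' hc' => ⟨?_, ?_⟩⟩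
  · obtain ⟨O, hO, h⟩ := hc.1
    obtain ⟨O', hO', h'⟩ := (continuousOn_iff'.1 c.h.continuousOn.fst) W hW
    refine ⟨O' ∩ O, hO'.inter hO, ?_⟩
    change {a | a ∈ c.h.source ∧ (c.h a).1 ∈ W} = _
    rw [inter_assoc, ← h, ← h']
    ext a
    exact and_comm
  · exact (hc.2 c' hc').1.mono fun z hz => ⟨c.mem_target.2 (hWV hz.1.1), hz.2⟩
  · exact (hc.2 c' hc').2.mono fun z hz => ⟨hz.1, hz.2.1⟩

/-- The chart restricted to `W` is again in the maximal atlas, and `W` is its own connected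
component. This is the source of arbitrarily small plaques. -/
theorem isPlaque_of_isPreconnected {c : LamChart A L.dim} (hc : c ∈ L.maxAtlas)
    {W : Set (Eucl L.dim)} (hW : IsOpen W) (hWV : W ⊆ c.V) (hW' : IsPreconnected W)
    (hne : W.Nonempty) (t : c.T) : L.IsPlaque (c.h.symm '' (W ×ˢ {t})) := by
  obtain ⟨x, hx⟩ := hne
  refine ⟨c.restrict W hW hWV, restrict_mem_maxAtlas hc hW hWV, x, hx, t, ?_⟩
  change _ = c.h.symm '' (connectedComponentIn W x ×ˢ {t})
  rw [hW'.connectedComponentIn hx]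

theorem exists_isPlaque {a : A} (ha : a ∈ L.carrier) : ∃ P, L.IsPlaque P ∧ a ∈ P := by
  obtain ⟨c, hc, has⟩ := L.cover a ha
  have hV := c.mem_target.1 (c.h.map_source has)
  exact ⟨_, ⟨c, L.atlas_subset_maxAtlas hc, _, hV, (c.h a).2, rfl⟩, c.h a,
    ⟨mem_connectedComponentIn hV, rfl⟩, c.h.left_inv has⟩

/-! ### Plaques, morphisms and immersions of product laminations -/

section Prod

variable {A' : Type v} [MetricSpace A'] {L' : Lamination r A'}

theorem prod_mem_maxAtlas {c : LamChart A L.dim} {c' : LamChart A' L'.dim}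
    (hc : c ∈ L.maxAtlas) (hc' : c' ∈ L'.maxAtlas) : c.prod c' ∈ (L.prod L').maxAtlas := by
  refine ⟨?_, ?_⟩
  · obtain ⟨O, hO, h⟩ := hc.1
    obtain ⟨O', hO', h'⟩ := hc'.1
    refine ⟨O ×ˢ O', hO.prod hO', ?_⟩
    change c.h.source ×ˢ c'.h.source = (O ×ˢ O') ∩ (L.carrier ×ˢ L'.carrier)
    rw [h, h', prod_inter_prod]
  · rintro _ ⟨c₁, h₁, c₁', h₁', rfl⟩
    exact ⟨(hc.2 _ h₁).1.prod (hc'.2 _ h₁').1, (hc.2 _ h₁).2.prod (hc'.2 _ h₁').2⟩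

/-- Connected components of a product are products of components, and the identification of
Euclidean spaces, being a homeomorphism, carries components to components. -/
theorem IsPlaque.prod {P : Set A} {P' : Set A'} (h : L.IsPlaque P) (h' : L'.IsPlaque P') :
    (L.prod L').IsPlaque (P ×ˢ P') := by
  obtain ⟨c, hc, x, hx, t, rfl⟩ := h
  obtain ⟨c', hc', x', hx', t', rfl⟩ := h'
  let κ := (euclAdd L.dim L'.dim).toHomeomorph
  have hxx : κ.symm (x, x') ∈ (c.prod c').V := by
    change κ (κ.symm (x, x')) ∈ c.V ×ˢ c'.V
    rw [κ.apply_symm_apply]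
    exact ⟨hx, hx'⟩
  suffices h : (c.h.symm '' (connectedComponentIn c.V x ×ˢ {t})) ×ˢ
      (c'.h.symm '' (connectedComponentIn c'.V x' ×ˢ {t'})) =
      (c.prod c').h.symm '' (connectedComponentIn (c.prod c').V (κ.symm (x, x')) ×ˢ
        {((t, t') : c.T × c'.T)}) from
    ⟨c.prod c', prod_mem_maxAtlas hc hc', κ.symm (x, x'), hxx, (t, t'), h⟩
  have hcc : connectedComponentIn (c.prod c').V (κ.symm (x, x')) =
      κ.symm '' (connectedComponentIn c.V x ×ˢ connectedComponentIn c'.V x') := by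
    rw [← connectedComponentIn_prod hx hx', κ.symm.image_connectedComponentIn
      (show (x, x') ∈ c.V ×ˢ c'.V from ⟨hx, hx'⟩), κ.image_symm]
    rfl
  rw [hcc]
  ext ⟨a, a'⟩
  constructor
  · rintro ⟨⟨⟨y, t₁⟩, ⟨hy, rfl⟩, rfl⟩, ⟨⟨y', t₁'⟩, ⟨hy', rfl⟩, rfl⟩⟩
    refine ⟨(κ.symm (y, y'), (t₁, t₁')), ⟨⟨_, ⟨hy, hy'⟩, rfl⟩, rfl⟩, ?_⟩
    change (c.h.symm ((κ (κ.symm (y, y'))).1, t₁), c'.h.symm ((κ (κ.symm (y, y'))).2, t₁')) = _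
    rw [κ.apply_symm_apply]
  · rintro ⟨⟨z, t₁⟩, ⟨⟨⟨y, y'⟩, ⟨hy, hy'⟩, rfl⟩, ht⟩, hz⟩
    obtain rfl : t₁ = (t, t') := ht
    replace hz : (c.h.symm ((κ (κ.symm (y, y'))).1, t), c'.h.symm ((κ (κ.symm (y, y'))).2, t')) =
      (a, a') := hz
    rw [κ.apply_symm_apply] at hz
    exact ⟨⟨(y, t), ⟨hy, rfl⟩, congrArg Prod.fst hz⟩, ⟨(y', t'), ⟨hy', rfl⟩, congrArg Prod.snd hz⟩⟩

variable {B : Type*} {B' : Type*} [MetricSpace B] [MetricSpace B'] {N : Lamination r B}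
  {N' : Lamination r B'} {V : Set A} {V' : Set A'} {f : A → B} {f' : A' → B'}

theorem IsMorphismOn.prod (h : L.IsMorphismOn V N f) (h' : L'.IsMorphismOn V' N' f') :
    (L.prod L').IsMorphismOn (V ×ˢ V') (N.prod N') (Prod.map f f') := by
  refine ⟨fun a ha => ⟨h.1 ha.1, h'.1 ha.2⟩, h.2.1.prodMap h'.2.1, ?_⟩
  rintro _ ⟨c, hc, c', hc', rfl⟩ _ ⟨e, he, e', he', rfl⟩
  refine LeafwiseCr.prod (euclAdd _ _) (euclAdd _ _).symm (h.2.2 c hc e he) (h'.2.2 c' hc' e' he')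
    ?_ ?_ fun z _ => rfl
  · exact fun z hz => ⟨c.mem_target.2 hz.1.1.1, hz.2.1.1, hz.2.2.1⟩
  · exact fun z hz => ⟨c'.mem_target.2 hz.1.1.2, hz.2.1.2, hz.2.2.2⟩

theorem IsImmersionOn.prod (h : L.IsImmersionOn V N f) (h' : L'.IsImmersionOn V' N' f') :
    (L.prod L').IsImmersionOn (V ×ˢ V') (N.prod N') (Prod.map f f') := by
  refine ⟨h.1.prod h'.1, ?_⟩
  rintro _ ⟨c, hc, c', hc', rfl⟩ _ ⟨e, he, e', he', rfl⟩ z hz hzV hze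
  let x := euclAdd L.dim L'.dim z.1
  have k := h.2 c hc e he (x.1, z.2.1) (c.mem_target.2 hz.1.1) hzV.1 hze.1
  have k' := h'.2 c' hc' e' he' (x.2, z.2.2) (c'.mem_target.2 hz.1.2) hzV.2 hze.2
  exact injective_fderiv_prod (x := (z.1 : Eucl (L.dim + L'.dim))) (euclAdd L.dim L'.dim)
    (euclAdd N.dim N'.dim).symm
    (g₁ := fun y => (e.h (f (c.h.symm (y, z.2.1)))).1)
    (g₂ := fun y => (e'.h (f' (c'.h.symm (y, z.2.2)))).1) k k'

theorem IsImmersionIntoManifoldOn.prod {E H M : Type*} [NormedAddCommGroup E] [NormedSpace ℝ E]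
    [TopologicalSpace H] {I : ModelWithCorners ℝ E H} [TopologicalSpace M] [ChartedSpace H M]
    {E' H' M' : Type*} [NormedAddCommGroup E'] [NormedSpace ℝ E']
    [TopologicalSpace H'] {I' : ModelWithCorners ℝ E' H'} [TopologicalSpace M']
    [ChartedSpace H' M'] {i : A → M} {i' : A' → M'}
    (h : L.IsImmersionIntoManifoldOn I V i) (h' : L'.IsImmersionIntoManifoldOn I' V' i') :
    (L.prod L').IsImmersionIntoManifoldOn (I.prod I') (V ×ˢ V') (Prod.map i i') := by
  refine ⟨h.1.prodMap h'.1, ?_⟩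
  rintro _ ⟨c, hc, c', hc', rfl⟩ m
  have k := h.2 c hc m.1
  have k' := h'.2 c' hc' m.2
  rw [extChartAt_prod]
  generalize extChartAt I m.1 = e at k ⊢
  generalize extChartAt I' m.2 = e' at k' ⊢
  refine ⟨?_, fun z hz hzV hze => ?_⟩
  · exact ContDiffLeafwiseOn.prod (D := {z | z ∈ (c.prod c').h.target ∧
      (c.prod c').h.symm z ∈ V ×ˢ V' ∧
      Prod.map i i' ((c.prod c').h.symm z) ∈ e.source ×ˢ e'.source})
      (euclAdd L.dim L'.dim) k.1 k'.1
      (fun z hz => ⟨c.mem_target.2 hz.1.1.1, hz.2.1.1, hz.2.2.1⟩)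
      (fun z hz => ⟨c'.mem_target.2 hz.1.1.2, hz.2.1.2, hz.2.2.2⟩)
  · exact injective_fderiv_prod (euclAdd L.dim L'.dim) (ContinuousLinearEquiv.refl ℝ (E × E'))
      (k.2 ((euclAdd _ _ z.1).1, z.2.1) (c.mem_target.2 hz.1.1) hzV.1 hze.1)
      (k'.2 ((euclAdd _ _ z.1).2, z.2.2) (c'.mem_target.2 hz.1.2) hzV.2 hze.2)

end Prod

end Lamination

/-! ## Leafwise connected sets -/

namespace Lamination

variable {r : ℕ∞} {A : Type u} [MetricSpace A] {L : Lamination r A}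

/-- A leafwise connected set: a continuous image of a preconnected subset of a Euclidean space along
which the transversal coordinates of the charts are locally constant. -/
def IsLeafwiseConnected (L : Lamination r A) (Q : Set A) : Prop :=
  ∃ (n : ℕ) (C : Set (Eucl n)) (g : Eucl n → A), IsPreconnected C ∧ ContinuousOn g C ∧
    MapsTo g C L.carrier ∧ Q = g '' C ∧ ∀ c ∈ L.atlas, ∀ w ∈ C, g w ∈ c.h.source →
      ∀ᶠ w' in 𝓝[C] w, g w' ∈ c.h.source ∧ (c.h (g w')).2 = (c.h (g w)).2

/-- The leaf coordinate parametrizes the plaque. Along it the transversal coordinate of any atlas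
chart is locally constant by compatibility of the charts. -/
theorem IsPlaque.isLeafwiseConnected {P : Set A} (h : L.IsPlaque P) :
    L.IsLeafwiseConnected P := by
  obtain ⟨c, hc, x, hx, t, rfl⟩ := h
  have hsub := connectedComponentIn_subset c.V x
  have hsrc : ∀ w ∈ connectedComponentIn c.V x, c.h.symm (w, t) ∈ c.h.source :=
    fun w hw => c.h.map_target (c.mem_target.2 (hsub hw))
  have hcont : ContinuousOn (fun w => c.h.symm (w, t)) (connectedComponentIn c.V x) :=
    c.h.continuousOn_symm.comp (by fun_prop) fun w hw => c.mem_target.2 (hsub hw)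
  have hmaps : MapsTo (fun w => c.h.symm (w, t)) (connectedComponentIn c.V x) L.carrier :=
    fun w hw => source_subset hc (hsrc w hw)
  refine ⟨_, _, fun w => c.h.symm (w, t), isPreconnected_connectedComponentIn, hcont, hmaps, ?_,
    fun c' hc' w hw hws => ?_⟩
  · ext a
    constructor
    · rintro ⟨⟨y, s⟩, ⟨hy, rfl⟩, rfl⟩
      exact ⟨y, hy, rfl⟩
    · rintro ⟨y, hy, rfl⟩
      exact ⟨(y, t), ⟨hy, rfl⟩, rfl⟩
  · have e₁ : ∀ᶠ w' in 𝓝[connectedComponentIn c.V x] w, c.h.symm (w', t) ∈ c'.h.source :=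
      ((hcont w hw).tendsto_nhdsWithin hmaps)
        (source_mem_nhdsWithin (L.atlas_subset_maxAtlas hc') hws)
    have hl := (hc.2 c' hc').1.2 (w, t) ⟨c.mem_target.2 (hsub hw), hws⟩
    -- Points of the component near `w` stay in the overlap of the two charts, so the local
    -- constancy known on the overlap applies to them.
    have hle : 𝓝[connectedComponentIn c.V x] w ≤ 𝓝[{y | (y, t) ∈ c.overlap c'}] w := by
      refine le_inf nhdsWithin_le_nhds (le_principal_iff.2 ?_)
      filter_upwards [e₁, self_mem_nhdsWithin] with y hy hyC
      exact ⟨c.mem_target.2 (hsub hyC), hy⟩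
    exact e₁.and (hle hl)

/-- A locally constant function on a preconnected set is constant; `hQ` keeps the whole set in one
chart, so that the coordinate is meaningful at every parameter. -/
theorem IsLeafwiseConnected.snd_eq {Q : Set A} (h : L.IsLeafwiseConnected Q)
    {c : LamChart A L.dim} (hc : c ∈ L.atlas) (hQ : Q ⊆ c.h.source) {x y : A} (hx : x ∈ Q)
    (hy : y ∈ Q) : (c.h x).2 = (c.h y).2 := by
  obtain ⟨n, C, g, hC, -, -, rfl, hl⟩ := h
  obtain ⟨u, hu, rfl⟩ := hx
  obtain ⟨v, hv, rfl⟩ := hy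
  refine hC.induction₂ (fun u v => (c.h (g u)).2 = (c.h (g v)).2) (fun w hw => ?_)
    (fun _ _ _ _ _ _ => Eq.trans) (fun _ _ _ _ => Eq.symm) hu hv
  filter_upwards [hl c hc w hw (hQ ⟨w, hw, rfl⟩)] with w' hw'
  exact hw'.2.symm

/-- Near each parameter the image stays in a single plaque of an atlas chart, so membership in a set
saturated by plaques is locally constant along the parametrization. -/
theorem IsLeafwiseConnected.subset_of_plaques {Q : Set A} (h : L.IsLeafwiseConnected Q) {S : Set A}
    (hS : ∀ P, L.IsPlaque P → (P ∩ S).Nonempty → P ⊆ S) (hQS : (Q ∩ S).Nonempty) : Q ⊆ S := by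
  obtain ⟨n, C, g, hC, hg, hgL, rfl, hl⟩ := h
  obtain ⟨_, ⟨u, hu, rfl⟩, huS⟩ := hQS
  rintro _ ⟨v, hv, rfl⟩
  refine (hC.induction₂ (fun u v => g u ∈ S ↔ g v ∈ S) (fun w hw => ?_)
    (fun _ _ _ _ _ _ => Iff.trans) (fun _ _ _ _ => Iff.symm) hu hv).1 huS
  obtain ⟨c, hc, hws⟩ := L.cover _ (hgL hw)
  have hcm := L.atlas_subset_maxAtlas hc
  have hV := c.mem_target.1 (c.h.map_source hws)
  have hnhds : connectedComponentIn c.V (c.h (g w)).1 ∈ 𝓝 (c.h (g w)).1 :=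
    c.isOpen_V.connectedComponentIn.mem_nhds (mem_connectedComponentIn hV)
  have htend : Tendsto (fun w' => (c.h (g w')).1) (𝓝[C] w) (𝓝 (c.h (g w)).1) :=
    (continuous_fst.tendsto _).comp ((continuousWithinAt_chart hcm hws).tendsto.comp
      ((hg w hw).tendsto_nhdsWithin hgL))
  filter_upwards [hl c hc w hw hws, htend hnhds] with w' hw' hcomp
  have hP : L.IsPlaque (c.h.symm '' (connectedComponentIn c.V (c.h (g w)).1 ×ˢ {(c.h (g w)).2})) :=
    ⟨c, hcm, _, hV, _, rfl⟩
  have m : g w ∈ c.h.symm '' (connectedComponentIn c.V (c.h (g w)).1 ×ˢ {(c.h (g w)).2}) :=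
    ⟨c.h (g w), ⟨mem_connectedComponentIn hV, rfl⟩, c.h.left_inv hws⟩
  have m' : g w' ∈ c.h.symm '' (connectedComponentIn c.V (c.h (g w)).1 ×ˢ {(c.h (g w)).2}) :=
    ⟨c.h (g w'), ⟨hcomp, hw'.2⟩, c.h.left_inv hw'.1⟩
  exact ⟨fun k => hS _ hP ⟨_, m, k⟩ m', fun k => hS _ hP ⟨_, m', k⟩ m⟩

/-! ### Leaves, and leaves of products -/

theorem mem_leaf (x : A) : x ∈ L.leaf x := mem_sInter.2 fun _ hS => hS.1

theorem IsPlaque.subset_leaf {x : A} {P : Set A} (hP : L.IsPlaque P)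
    (h : (P ∩ L.leaf x).Nonempty) : P ⊆ L.leaf x := by
  obtain ⟨y, hyP, hy⟩ := h
  exact subset_sInter fun S hS => hS.2 P hP ⟨y, hyP, mem_sInter.1 hy S hS⟩

theorem leaf_subset {x : A} {S : Set A} (hx : x ∈ S)
    (hS : ∀ P, L.IsPlaque P → (P ∩ S).Nonempty → P ⊆ S) : L.leaf x ⊆ S :=
  sInter_subset_of_mem ⟨hx, hS⟩

theorem IsPlaque.subset_carrier {P : Set A} (h : L.IsPlaque P) : P ⊆ L.carrier := by
  obtain ⟨n, C, g, -, -, hg, rfl, -⟩ := h.isLeafwiseConnected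
  exact hg.image_subset

theorem leaf_subset_carrier {x : A} (hx : x ∈ L.carrier) : L.leaf x ⊆ L.carrier :=
  leaf_subset hx fun _ hP _ => hP.subset_carrier

section Prod

variable {A' : Type v} [MetricSpace A'] {L' : Lamination r A'}

/-- The parametrization is composed with the projection. A chart of the first factor is completed to
a product chart by any chart around the second coordinate, and the transversal coordinate of the
product chart is a pair. -/
theorem IsLeafwiseConnected.image_fst {Q : Set (A × A')} (h : (L.prod L').IsLeafwiseConnected Q) :
    L.IsLeafwiseConnected (Prod.fst '' Q) := by
  obtain ⟨n, C, g, hC, hg, hgL, rfl, hl⟩ := h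
  refine ⟨n, C, fun w => (g w).1, hC, hg.fst, fun w hw => (hgL hw).1, by rw [image_image],
    fun c hc w hw hws => ?_⟩
  obtain ⟨c', hc', hws'⟩ := L'.cover _ (hgL hw).2
  filter_upwards [hl (c.prod c') ⟨c, hc, c', hc', rfl⟩ w hw ⟨hws, hws'⟩] with w' hw'
  exact ⟨hw'.1.1, congrArg (fun q : c.T × c'.T => q.1) hw'.2⟩

theorem IsLeafwiseConnected.image_snd {Q : Set (A × A')} (h : (L.prod L').IsLeafwiseConnected Q) :
    L'.IsLeafwiseConnected (Prod.snd '' Q) := by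
  obtain ⟨n, C, g, hC, hg, hgL, rfl, hl⟩ := h
  refine ⟨n, C, fun w => (g w).2, hC, hg.snd, fun w hw => (hgL hw).2, by rw [image_image],
    fun c' hc' w hw hws' => ?_⟩
  obtain ⟨c, hc, hws⟩ := L.cover _ (hgL hw).1
  filter_upwards [hl (c.prod c') ⟨c, hc, c', hc', rfl⟩ w hw ⟨hws, hws'⟩] with w' hw'
  exact ⟨hw'.1.2, congrArg (fun q : c.T × c'.T => q.2) hw'.2⟩

/-- The product of the leaves is saturated, because both projections of a plaque are leafwise
connected. Conversely, product plaques allow moving along the first leaf with `x'` fixed, and then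
along the second. -/
theorem leaf_prod {x : A} {x' : A'} (hx : x ∈ L.carrier) (hx' : x' ∈ L'.carrier) :
    (L.prod L').leaf (x, x') = L.leaf x ×ˢ L'.leaf x' := by
  apply Subset.antisymm
  · refine leaf_subset ⟨mem_leaf x, mem_leaf x'⟩ fun Q hQ hne => ?_
    obtain ⟨z, hzQ, hz⟩ := hne
    have h := hQ.isLeafwiseConnected
    have h₁ := h.image_fst.subset_of_plaques (S := L.leaf x) (fun P => IsPlaque.subset_leaf)
      ⟨z.1, ⟨z, hzQ, rfl⟩, hz.1⟩
    have h₂ := h.image_snd.subset_of_plaques (S := L'.leaf x') (fun P => IsPlaque.subset_leaf)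
      ⟨z.2, ⟨z, hzQ, rfl⟩, hz.2⟩
    exact fun w hw => ⟨h₁ ⟨w, hw, rfl⟩, h₂ ⟨w, hw, rfl⟩⟩
  · have hsat : ∀ P, (L.prod L').IsPlaque P → (P ∩ (L.prod L').leaf (x, x')).Nonempty →
        P ⊆ (L.prod L').leaf (x, x') := fun P => IsPlaque.subset_leaf
    have h₁ : ∀ y ∈ L.leaf x, (y, x') ∈ (L.prod L').leaf (x, x') := by
      refine leaf_subset (S := {y | (y, x') ∈ (L.prod L').leaf (x, x')}) (mem_leaf (x, x'))
        fun P hP hne y hy => ?_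
      obtain ⟨z, hzP, hz⟩ := hne
      obtain ⟨P', hP', hxP'⟩ := exists_isPlaque hx'
      exact hsat _ (hP.prod hP') ⟨(z, x'), ⟨hzP, hxP'⟩, hz⟩ ⟨hy, hxP'⟩
    rintro ⟨y, y'⟩ ⟨hy, hy'⟩
    refine leaf_subset (L := L') (S := {y' | (y, y') ∈ (L.prod L').leaf (x, x')}) (h₁ y hy)
      (fun P' hP' hne w' hw' => ?_) hy'
    obtain ⟨z', hzP', hz'⟩ := hne
    obtain ⟨P, hP, hyP⟩ := exists_isPlaque (leaf_subset_carrier hx hy)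
    exact hsat _ (hP.prod hP') ⟨(y, z'), ⟨hyP, hzP'⟩, hz'⟩ ⟨hyP, hw'⟩

theorem FoliatesOnInter.prod {N : Lamination r A} {N' : Lamination r A'}
    (h : L.FoliatesOnInter N) (h' : L'.FoliatesOnInter N') :
    (L.prod L').FoliatesOnInter (N.prod N') := by
  rintro ⟨x, x'⟩ ⟨hxL, hxN⟩
  obtain ⟨c, hc, e, he, hxc, hce, k, κ, U, θ, hU, hθ⟩ := h x ⟨hxL.1, hxN.1⟩
  obtain ⟨c', hc', e', he', hxc', hce', k', κ', U', θ', hU', hθ'⟩ := h' x' ⟨hxL.2, hxN.2⟩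
  -- Both leaf and normal coordinates are split into their two factors, regrouped factor by factor,
  -- sent through `κ` and `κ'`, and recombined. `Θ` is the matching regrouping of the transversals.
  let σ : (Eucl (L.dim + L'.dim) × Eucl (k + k')) ≃L[ℝ] Eucl (N.dim + N'.dim) :=
    ((euclAdd L.dim L'.dim).prodCongr (euclAdd k k')).trans
      ((ContinuousLinearEquiv.prodProdProdComm ℝ _ _ _ _).trans
        ((κ.prodCongr κ').trans (euclAdd N.dim N'.dim).symm))
  let W : Set (Eucl (k + k')) := euclAdd k k' ⁻¹' (U ×ˢ U')
  let τ : (U × U') ≃ₜ W :=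
    { toFun := fun p => ⟨(euclAdd k k').symm (p.1, p.2), by
        change euclAdd k k' _ ∈ U ×ˢ U'
        rw [(euclAdd k k').apply_symm_apply]
        exact ⟨p.1.2, p.2.2⟩⟩
      invFun := fun p => (⟨(euclAdd k k' p).1, p.2.1⟩, ⟨(euclAdd k k' p).2, p.2.2⟩)
      left_inv := fun p => by
        apply Prod.ext <;> apply Subtype.ext <;> simp
      right_inv := fun p => by
        apply Subtype.ext
        exact (euclAdd k k').symm_apply_apply p
      continuous_toFun := by fun_prop
      continuous_invFun := by fun_prop }
  let Θ : (c.T × c'.T) ≃ₜ W × (e.T × e'.T) :=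
    ((θ.prodCongr θ').trans (Homeomorph.prodProdProdComm _ _ _ _)).trans
      (τ.prodCongr (Homeomorph.refl _))
  refine ⟨c.prod c', prod_mem_maxAtlas hc hc', e.prod e', prod_mem_maxAtlas he he', ⟨hxc, hxc'⟩,
    ?_, k + k', σ, W, Θ, (hU.prod hU').preimage (euclAdd k k').continuous, ?_⟩
  · change c.h.source ×ˢ c'.h.source = e.h.source ×ˢ e'.h.source
    rw [hce, hce']
  · rintro ⟨y, y'⟩ ⟨hy, hy'⟩
    have q := hθ y hy
    have q' := hθ' y' hy'
    change ((euclAdd N.dim N'.dim).symm ((e.h y).1, (e'.h y').1), ((e.h y).2, (e'.h y').2)) = _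
    rw [q, q']
    change _ = ((euclAdd N.dim N'.dim).symm
      (κ ((euclAdd L.dim L'.dim ((euclAdd L.dim L'.dim).symm ((c.h y).1, (c'.h y').1))).1,
        (euclAdd k k' ((euclAdd k k').symm
          (((θ (c.h y).2).1 : Eucl k), ((θ' (c'.h y').2).1 : Eucl k')))).1),
      κ' ((euclAdd L.dim L'.dim ((euclAdd L.dim L'.dim).symm ((c.h y).1, (c'.h y').1))).2,
        (euclAdd k k' ((euclAdd k k').symm
          (((θ (c.h y).2).1 : Eucl k), ((θ' (c'.h y').2).1 : Eucl k')))).2)),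
      ((θ (c.h y).2).2, (θ' (c'.h y').2).2))
    rw [(euclAdd k k').apply_symm_apply, (euclAdd L.dim L'.dim).apply_symm_apply]

end Prod

/-! ## Small plaques -/

/-- A small box around `c.h a` is mapped by `c.h.symm` into a small ball. Its horizontal slices are
uniformly small plaques, and nearby points with equal transversal coordinate lie in the same slice.
-/
theorem exists_small_plaques {a : A} {c : LamChart A L.dim} (hc : c ∈ L.atlas)
    (ha : a ∈ c.h.source) {e : ℝ} (he : 0 < e) :
    ∃ ρ > 0, Metric.ball a ρ ∩ L.carrier ⊆ c.h.source ∧ ∀ x ∈ Metric.ball a ρ ∩ L.carrier,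
      ∃ P, L.IsPlaque P ∧ Metric.ediam P < ENNReal.ofReal e ∧
        ∀ y ∈ Metric.ball a ρ ∩ L.carrier, (c.h y).2 = (c.h x).2 → y ∈ P := by
  have hcm := L.atlas_subset_maxAtlas hc
  have hat := c.h.map_source ha
  have hVn : c.V ∈ 𝓝 (c.h a).1 := c.isOpen_V.mem_nhds (c.mem_target.1 hat)
  have htgt : c.h.target ∈ 𝓝 (c.h a) := by
    rw [c.target_eq]
    exact prod_mem_nhds hVn univ_mem
  have hcs : ContinuousAt c.h.symm (c.h a) := (c.h.continuousOn_symm _ hat).continuousAt htgt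
  -- Radius `e / 3` bounds the diameter by `2 * e / 3`, strictly below `e`.
  have hpre : ∀ᶠ z in 𝓝 (c.h a), c.h.symm z ∈ Metric.ball a (e / 3) := by
    refine hcs ?_
    rw [c.h.left_inv ha]
    exact Metric.ball_mem_nhds _ (by positivity)
  obtain ⟨U, hU, T₀, hT₀, hUT⟩ := mem_nhds_prod_iff.1 hpre
  obtain ⟨s, hs, hsU⟩ := Metric.mem_nhds_iff.1 (inter_mem hU hVn)
  have hev : {x | x ∈ c.h.source ∧ c.h x ∈ Metric.ball (c.h a).1 s ×ˢ T₀} ∈ 𝓝[L.carrier] a :=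
    inter_mem (source_mem_nhdsWithin hcm ha) ((continuousWithinAt_chart hcm ha)
      (prod_mem_nhds (Metric.ball_mem_nhds _ hs) hT₀))
  obtain ⟨ρ, hρ, hρs⟩ := Metric.mem_nhdsWithin_iff.1 hev
  refine ⟨ρ, hρ, fun x hx => (hρs hx).1, fun x hx => ?_⟩
  refine ⟨_, isPlaque_of_isPreconnected hcm Metric.isOpen_ball
    (hsU.trans inter_subset_right) (convex_ball _ s).isPreconnected ⟨_, Metric.mem_ball_self hs⟩
    (c.h x).2, ?_, fun y hy hyx => ⟨c.h y, ⟨(hρs hy).2.1, hyx⟩, c.h.left_inv (hρs hy).1⟩⟩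
  have hsub : c.h.symm '' (Metric.ball (c.h a).1 s ×ˢ {(c.h x).2}) ⊆ Metric.ball a (e / 3) := by
    rintro _ ⟨⟨u, t⟩, ⟨hu, rfl⟩, rfl⟩
    exact hUT ⟨(hsU hu).1, (hρs hx).2.2⟩
  calc _ ≤ Metric.ediam (Metric.ball a (e / 3)) := Metric.ediam_mono hsub
    _ ≤ ENNReal.ofReal (2 * (e / 3)) := by
      refine Metric.ediam_le fun y hy z hz => ?_
      rw [edist_dist]
      refine ENNReal.ofReal_le_ofReal ?_
      have := dist_triangle_right y z a
      rw [Metric.mem_ball] at hy hz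
      linarith
    _ < ENNReal.ofReal e := (ENNReal.ofReal_lt_ofReal_iff he).2 (by linarith)

end Lamination

/-! ## Coherence of a tubular neighborhood with its stratum -/

namespace Lamination

variable {r : ℕ∞} {A : Type u} [MetricSpace A] {L : Lamination r A}

/-- In charts, an immersion between leaves of equal dimension is open at each point. The image of a
plaque of `L` therefore contains a ball in a slice of a chart of `N`, and this ball is a plaque of
`N`. -/
theorem IsImmersionOn.coherent {N : Lamination r A} (hr : 1 ≤ r) (hd : L.dim = N.dim)
    (h : L.IsImmersionOn L.carrier N id) : N.Coherent L := by
  rintro x ⟨-, hxL⟩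
  obtain ⟨c, hc, hxc⟩ := L.cover x hxL
  obtain ⟨e, he, hxe⟩ := N.cover x (h.1.1 hxL)
  have hcm := L.atlas_subset_maxAtlas hc
  have hem := N.atlas_subset_maxAtlas he
  have hxt := c.h.map_source hxc
  have hV := c.mem_target.1 hxt
  have hsrc : ∀ u ∈ c.V, c.h.symm (u, (c.h x).2) ∈ c.h.source := fun u hu =>
    c.h.map_target (c.mem_target.2 hu)
  have hx : c.h.symm ((c.h x).1, (c.h x).2) = x := c.h.left_inv hxc
  have hcont : ContinuousWithinAt (fun u => c.h.symm (u, (c.h x).2)) c.V (c.h x).1 :=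
    c.h.continuousOn_symm.comp (by fun_prop) (fun u hu => c.mem_target.2 hu) _ hV
  have hVn := c.isOpen_V.mem_nhds hV
  have hes : ∀ᶠ u in 𝓝 (c.h x).1, c.h.symm (u, (c.h x).2) ∈ e.h.source := by
    have := hcont.tendsto_nhdsWithin
      (t := N.carrier) fun u hu => h.1.1 (source_subset hcm (hsrc u hu))
    rw [c.isOpen_V.nhdsWithin_eq hV, hx] at this
    exact this (source_mem_nhdsWithin hem hxe)
  obtain ⟨⟨⟨p, hp, -⟩, hl⟩, hinj⟩ := And.intro (h.1.2.2 c hc e he) (h.2 c hc e he)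
  have hD : {u | (u, (c.h x).2) ∈ {z | z ∈ c.h.target ∧ c.h.symm z ∈ L.carrier ∧
      id (c.h.symm z) ∈ e.h.source}} ∈ 𝓝 (c.h x).1 := by
    filter_upwards [hes, hVn] with u hu huV
    exact ⟨c.mem_target.2 huV, source_subset hcm (hsrc u huV), hu⟩
  -- Here `1 ≤ r` is essential: the Taylor series must reach order one to give strict
  -- differentiability.
  have hstrict := (hp (c.h x).2).hasStrictFDerivAt
    (by simpa using (zero_lt_one.trans_le hr).ne') hD
  have hi := hinj (c.h x) hxt (by simpa [hx] using hxL) (by simpa [hx] using hxe)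
  rw [hstrict.hasFDerivAt.fderiv] at hi
  have hsurj := (LinearMap.injective_iff_surjective_of_finrank_eq_finrank
    (f := (continuousMultilinearCurryFin1 ℝ (Eucl L.dim) (Eucl N.dim)
      (p ((c.h x).1, (c.h x).2) 1) : Eucl L.dim →ₗ[ℝ] Eucl N.dim)) (by simp [hd])).1 hi
  have hmap := hstrict.map_nhds_eq_of_surj (LinearMap.range_eq_top.2 hsurj)
  simp only [id_eq] at hmap
  rw [hx] at hmap
  have hl' := hl (c.h x)
    ⟨hxt, by simpa [c.h.left_inv hxc] using hxL, by simpa [c.h.left_inv hxc] using hxe⟩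
  rw [nhdsWithin_eq_nhds.2 hD] at hl'
  simp only [id_eq] at hl'
  rw [c.h.left_inv hxc] at hl'
  -- These parameters stay in the plaque of `L` through `x` and in the slice of `e` through `x`; by
  -- openness their leaf coordinates in `e` fill a ball.
  have hW : {u | u ∈ connectedComponentIn c.V (c.h x).1 ∧
      c.h.symm (u, (c.h x).2) ∈ e.h.source ∧
      (e.h (c.h.symm (u, (c.h x).2))).2 = (e.h x).2} ∈ 𝓝 (c.h x).1 := by
    filter_upwards [hes, hl', c.isOpen_V.connectedComponentIn.mem_nhds
      (mem_connectedComponentIn hV)] with u h₁ h₂ h₃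
    exact ⟨h₃, h₁, h₂⟩
  have hball := image_mem_map (m := fun u => (e.h (c.h.symm (u, (c.h x).2))).1) hW
  rw [hmap] at hball
  obtain ⟨s, hs, hsb⟩ := Metric.mem_nhds_iff.1 hball
  have hsV : Metric.ball (e.h x).1 s ⊆ e.V := fun v hv => by
    obtain ⟨u, hu, rfl⟩ := hsb hv
    exact e.mem_target.1 (e.h.map_source hu.2.1)
  refine ⟨_, _, isPlaque_of_isPreconnected hem Metric.isOpen_ball hsV
    (convex_ball _ s).isPreconnected ⟨_, Metric.mem_ball_self hs⟩ (e.h x).2,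
    ⟨c, hcm, _, hV, (c.h x).2, rfl⟩,
    ⟨e.h x, ⟨Metric.mem_ball_self hs, rfl⟩, e.h.left_inv hxe⟩, ?_⟩
  rintro _ ⟨⟨v, t⟩, ⟨hv, rfl⟩, rfl⟩
  obtain ⟨u, ⟨hu, hus, hut⟩, rfl⟩ := hsb hv
  refine ⟨(u, (c.h x).2), ⟨hu, rfl⟩, ?_⟩
  rw [← hut]
  exact (e.h.left_inv hus).symm

end Lamination

/-! ## Positive functions chosen locally -/

/-- By `hmono` the admissible positive values at a point form an interval, hence a convex set, so
locally constant choices can be glued by a partition of unity. -/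
theorem exists_continuousOn_pos_of_local {A : Type*} [MetricSpace A] (s : Set A)
    (P : A → ℝ → Prop) (hmono : ∀ x a b, 0 < a → a ≤ b → P x b → P x a)
    (H : ∀ a ∈ s, ∃ ρ > 0, ∀ᶠ x in 𝓝[s] a, P x ρ) :
    ∃ η : A → ℝ, ContinuousOn η s ∧ (∀ x ∈ s, 0 < η x) ∧ ∀ x ∈ s, P x (η x) := by
  classical
  have hconv : ∀ x : s, Convex ℝ {ρ : ℝ | 0 < ρ ∧ P x ρ} := fun x => by
    refine OrdConnected.convex ⟨fun a ha b hb ρ hρ => ?_⟩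
    have h0 := ha.1.trans_le hρ.1
    exact ⟨h0, hmono _ _ _ h0 hρ.2 hb.2⟩
  have hloc : ∀ x : s, ∃ ρ : ℝ, ∀ᶠ y : s in 𝓝 x, ρ ∈ {ρ : ℝ | 0 < ρ ∧ P y ρ} := fun x => by
    obtain ⟨ρ, hρ, h⟩ := H x x.2
    refine ⟨ρ, ?_⟩
    rw [nhdsWithin_eq_map_subtype_coe x.2, eventually_map] at h
    filter_upwards [h] with y hy
    exact ⟨hρ, hy⟩
  obtain ⟨g, hg⟩ := exists_continuous_forall_mem_convex_of_local_const hconv hloc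
  -- The value 1 off `s` is arbitrary.
  refine ⟨fun x => if h : x ∈ s then g ⟨x, h⟩ else 1, ?_, fun x hx => ?_, fun x hx => ?_⟩
  · rw [continuousOn_iff_continuous_domRestrict]
    convert g.continuous using 1
    ext x
    simp
  · simpa [hx] using (hg ⟨x, hx⟩).1
  · simpa [hx] using (hg ⟨x, hx⟩).2

/-! ### Comparison of small leafwise connected sets with small plaques -/

namespace Lamination

variable {r : ℕ∞} {A : Type u} [MetricSpace A] {L : Lamination r A}

theorem IsLeafwiseConnected.subset_carrier {Q : Set A} (h : L.IsLeafwiseConnected Q) :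
    Q ⊆ L.carrier := by
  obtain ⟨n, C, g, -, -, hg, rfl, -⟩ := h
  exact hg.image_subset

theorem dist_lt_of_ediam_lt {Q : Set A} {ρ : ℝ} {x y : A} (hQ : Metric.ediam Q < ENNReal.ofReal ρ)
    (hx : x ∈ Q) (hy : y ∈ Q) : dist x y < ρ :=
  edist_lt_ofReal.1 ((Metric.edist_le_ediam_of_mem hx hy).trans_lt hQ)

/-- At the points of `V`, leafwise connected sets that are small with respect to `κ` are contained
in plaques that are small with respect to `η`. -/
def RefinesPlaques (L : Lamination r A) (V : Set A) (κ η : A → ℝ) : Prop :=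
  ∀ x ∈ V, ∀ Q, L.IsLeafwiseConnected Q → x ∈ Q → Metric.ediam Q < ENNReal.ofReal (κ x) →
    ∃ P, L.IsPlaque P ∧ Q ⊆ P ∧ Metric.ediam P < ENNReal.ofReal (η x)

theorem exists_refinesPlaques {V : Set A} (hV : V ⊆ L.carrier) {η : A → ℝ}
    (hη : ContinuousOn η V) (hpos : ∀ x ∈ V, 0 < η x) :
    ∃ κ : A → ℝ, ContinuousOn κ V ∧ (∀ x ∈ V, 0 < κ x) ∧ L.RefinesPlaques V κ η := by
  refine exists_continuousOn_pos_of_local V (fun x ρ => ∀ Q, L.IsLeafwiseConnected Q → x ∈ Q →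
    Metric.ediam Q < ENNReal.ofReal ρ →
    ∃ P, L.IsPlaque P ∧ Q ⊆ P ∧ Metric.ediam P < ENNReal.ofReal (η x))
    (fun x a b _ hab h Q hQ hx hd => h Q hQ hx (hd.trans_le (ENNReal.ofReal_le_ofReal hab)))
    fun a ha => ?_
  obtain ⟨c, hc, hac⟩ := L.cover a (hV ha)
  -- Plaques smaller than `η a / 2` are smaller than `η x` for all `x` near `a`.
  have hη' := half_pos (hpos a ha)
  obtain ⟨ρ, hρ, hρs, hρP⟩ := exists_small_plaques hc hac hη'
  -- If `x` is within `ρ / 2` of `a`, a set through `x` of diameter below `ρ / 2` stays in the ball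
  -- of radius `ρ`, hence in one chart domain.
  refine ⟨ρ / 2, half_pos hρ, ?_⟩
  filter_upwards [(hη a ha).eventually (lt_mem_nhds (half_lt_self (hpos a ha))),
    mem_nhdsWithin_of_mem_nhds (Metric.ball_mem_nhds a (half_pos hρ))] with x hx hxa Q hQ hxQ hd
  have hQb : Q ⊆ Metric.ball a ρ ∩ L.carrier := fun y hy => by
    refine ⟨?_, hQ.subset_carrier hy⟩
    have h₁ := dist_lt_of_ediam_lt hd hy hxQ
    have h₂ := dist_triangle y x a
    rw [Metric.mem_ball] at hxa ⊢
    linarith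
  obtain ⟨P, hP, hPd, hPQ⟩ := hρP x (hQb hxQ)
  exact ⟨P, hP, fun y hy => hPQ y (hQb hy) (hQ.snd_eq hc (hQb.trans hρs) hy hxQ),
    hPd.trans_le (ENNReal.ofReal_le_ofReal hx.le)⟩

/-- Plaques that are small with respect to `δ` are contained, with some room, in the domain of a
chart of the atlas. -/
theorem exists_ball_subset_source (L : Lamination r A) :
    ∃ δ : A → ℝ, ContinuousOn δ L.carrier ∧ (∀ x ∈ L.carrier, 0 < δ x) ∧
      ∀ x ∈ L.carrier, ∃ c ∈ L.atlas, Metric.ball x (2 * δ x) ∩ L.carrier ⊆ c.h.source := by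
  refine exists_continuousOn_pos_of_local L.carrier (fun x ρ => ∃ c ∈ L.atlas,
    Metric.ball x (2 * ρ) ∩ L.carrier ⊆ c.h.source) ?_ fun a ha => ?_
  · rintro x a b - hab ⟨c, hc, h⟩
    exact ⟨c, hc, (inter_subset_inter_left _ (Metric.ball_subset_ball (by linarith))).trans h⟩
  · obtain ⟨c, hc, hac⟩ := L.cover a ha
    obtain ⟨ρ, hρ, hρs⟩ := Metric.mem_nhdsWithin_iff.1
      (source_mem_nhdsWithin (L.atlas_subset_maxAtlas hc) hac)
    -- The ball of radius `2 * ρ / 3` about a point within `ρ / 3` of `a` lies in the ball of radius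
    -- `ρ` about `a`.
    refine ⟨ρ / 3, by positivity, ?_⟩
    filter_upwards [mem_nhdsWithin_of_mem_nhds (Metric.ball_mem_nhds a (by positivity : 0 < ρ / 3))]
      with x hx
    refine ⟨c, hc, (inter_subset_inter_left _ (Metric.ball_subset_ball' ?_)).trans hρs⟩
    rw [Metric.mem_ball] at hx
    linarith

/-- Close points of a plaque that is contained in a chart domain are in a common small plaque. -/
theorem exists_common_small_plaque {δ : A → ℝ} (hδ : ContinuousOn δ L.carrier)
    (hpos : ∀ x ∈ L.carrier, 0 < δ x)
    (hsrc : ∀ x ∈ L.carrier, ∃ c ∈ L.atlas, Metric.ball x (2 * δ x) ∩ L.carrier ⊆ c.h.source)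
    {a : A} (ha : a ∈ L.carrier) {e : ℝ} (he : 0 < e) :
    ∃ ρ > 0, ∀ x ∈ Metric.ball a ρ ∩ L.carrier, ∀ y, dist x y < ρ →
      (∃ P, L.IsPlaque P ∧ x ∈ P ∧ y ∈ P ∧ Metric.ediam P < ENNReal.ofReal (δ x)) →
      ∃ P, L.IsPlaque P ∧ x ∈ P ∧ y ∈ P ∧ Metric.ediam P < ENNReal.ofReal e := by
  obtain ⟨c, hc, hac⟩ := hsrc a ha
  have hda := hpos a ha
  obtain ⟨ρ₀, hρ₀, -, hρP⟩ := exists_small_plaques hc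
    (hac ⟨Metric.mem_ball_self (by positivity), ha⟩) he
  obtain ⟨ρ₁, hρ₁, hρδ⟩ := Metric.mem_nhdsWithin_iff.1
    ((hδ a ha).eventually (gt_mem_nhds (by linarith : δ a < 3 / 2 * δ a)))
  -- The first bound puts both `x` and `y` in the ball of radius `ρ₀`. The other two put the given
  -- plaque within `3 / 2 * δ a + δ a / 2 = 2 * δ a` of `a`, hence in the chart domain.
  refine ⟨min (ρ₀ / 2) (min ρ₁ (δ a / 2)), by positivity, ?_⟩
  rintro x ⟨hxa, hxL⟩ y hxy ⟨P, hP, hxP, hyP, hd⟩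
  rw [Metric.mem_ball, lt_min_iff, lt_min_iff] at hxa
  have hδx : δ x < 3 / 2 * δ a := hρδ ⟨hxa.2.1, hxL⟩
  have hPs : P ⊆ c.h.source := fun z hz => by
    refine hac ⟨?_, hP.subset_carrier hz⟩
    have h₁ := dist_lt_of_ediam_lt hd hz hxP
    have h₂ := dist_triangle z x a
    rw [Metric.mem_ball]
    linarith [hxa.2.2]
  have hya : dist y a < ρ₀ := by
    have h₁ := dist_triangle_left y a x
    have h₂ := hxy.trans_le (min_le_left _ _)
    linarith [hxa.1]
  have hxa' : x ∈ Metric.ball a ρ₀ ∩ L.carrier := ⟨by rw [Metric.mem_ball]; linarith [hxa.1], hxL⟩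
  obtain ⟨P', hP', hd', hPP⟩ := hρP x hxa'
  exact ⟨P', hP', hPP x hxa' rfl, hPP y ⟨hya, hP.subset_carrier hyP⟩
    (hP.isLeafwiseConnected.snd_eq hc hPs hyP hxP), hd'⟩

/-! ### Pseudo-orbits and plaque-expansiveness in products -/

section Prod

variable {A' : Type v} [MetricSpace A'] {L' : Lamination r A'} {V : Set A} {V' : Set A'}
  {f : A → A} {f' : A' → A'}

/-- The projected plaque is leafwise connected and, in the maximum metric, of no larger diameter, so
`h` encloses it in a plaque of the required size. -/
theorem IsPseudoOrbit.fst {κ η : A → ℝ} {H : A × A' → ℝ} {p : ℕ → A × A'}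
    (hp : (L.prod L').IsPseudoOrbit (V ×ˢ V') (Prod.map f f') H p) (h : L.RefinesPlaques V κ η)
    (hH : ∀ x ∈ V ×ˢ V', H x ≤ κ x.1) : L.IsPseudoOrbit V f η fun n => (p n).1 := by
  refine ⟨fun n => (hp.1 n).1, fun n => ?_⟩
  obtain ⟨Q, hQ, hf, hn, hd⟩ := hp.2 n
  obtain ⟨P, hP, hQP, hPd⟩ := h _ (hp.1 (n + 1)).1 _ hQ.isLeafwiseConnected.image_fst
    ⟨_, hn, rfl⟩ (lt_of_le_of_lt (Metric.ediam_image_le_iff.2 fun x hx y hy =>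
      (le_max_left _ _).trans (Metric.edist_le_ediam_of_mem hx hy))
      (hd.trans_le (ENNReal.ofReal_le_ofReal (hH _ (hp.1 (n + 1))))))
  exact ⟨P, hP, hQP ⟨_, hf, rfl⟩, hQP ⟨_, hn, rfl⟩, hPd⟩

theorem IsPseudoOrbit.snd {κ η : A' → ℝ} {H : A × A' → ℝ} {p : ℕ → A × A'}
    (hp : (L.prod L').IsPseudoOrbit (V ×ˢ V') (Prod.map f f') H p) (h : L'.RefinesPlaques V' κ η)
    (hH : ∀ x ∈ V ×ˢ V', H x ≤ κ x.2) : L'.IsPseudoOrbit V' f' η fun n => (p n).2 := by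
  refine ⟨fun n => (hp.1 n).2, fun n => ?_⟩
  obtain ⟨Q, hQ, hf, hn, hd⟩ := hp.2 n
  obtain ⟨P, hP, hQP, hPd⟩ := h _ (hp.1 (n + 1)).2 _ hQ.isLeafwiseConnected.image_snd
    ⟨_, hn, rfl⟩ (lt_of_le_of_lt (Metric.ediam_image_le_iff.2 fun x hx y hy =>
      (le_max_right _ _).trans (Metric.edist_le_ediam_of_mem hx hy))
      (hd.trans_le (ENNReal.ofReal_le_ofReal (hH _ (hp.1 (n + 1))))))
  exact ⟨P, hP, hQP ⟨_, hf, rfl⟩, hQP ⟨_, hn, rfl⟩, hPd⟩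

/-- The factors are used with chart-sized `σ` and `σ'`. Closeness of the initial points, controlled
by `θ`, then shrinks the common plaques to size `δ`. -/
theorem IsPlaqueExpansive.prod (h : L.IsPlaqueExpansive f) (h' : L'.IsPlaqueExpansive f') :
    (L.prod L').IsPlaqueExpansive (Prod.map f f') := by
  intro δ hδ hδpos
  obtain ⟨σ, hσ, hσpos, hσs⟩ := L.exists_ball_subset_source
  obtain ⟨σ', hσ', hσpos', hσs'⟩ := L'.exists_ball_subset_source
  obtain ⟨ε, hε, hεpos, hexp⟩ := h σ hσ hσpos
  obtain ⟨ε', hε', hεpos', hexp'⟩ := h' σ' hσ' hσpos'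
  -- The definition needs a continuous function strictly below `ε`; half of `ε` serves for the
  -- projected pseudo-orbits, whatever `η` on the product is.
  have hεhalf : ContinuousOn (fun x => ε x / 2) L.carrier := hε.div_const 2
  have hεhalf' : ContinuousOn (fun x => ε' x / 2) L'.carrier := hε'.div_const 2
  obtain ⟨κ, hκ, hκpos, href⟩ := exists_refinesPlaques subset_rfl hεhalf
    fun x hx => half_pos (hεpos x hx)
  obtain ⟨κ', hκ', hκpos', href'⟩ := exists_refinesPlaques subset_rfl hεhalf'
    fun x hx => half_pos (hεpos' x hx)
  obtain ⟨θ, hθ, hθpos, hθP⟩ := exists_continuousOn_pos_of_local (L.carrier ×ˢ L'.carrier)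
    (fun p s => (∀ y, dist p.1 y < s →
      (∃ P, L.IsPlaque P ∧ p.1 ∈ P ∧ y ∈ P ∧ Metric.ediam P < ENNReal.ofReal (σ p.1)) →
      ∃ P, L.IsPlaque P ∧ p.1 ∈ P ∧ y ∈ P ∧ Metric.ediam P < ENNReal.ofReal (δ p)) ∧
      ∀ y, dist p.2 y < s →
      (∃ P, L'.IsPlaque P ∧ p.2 ∈ P ∧ y ∈ P ∧ Metric.ediam P < ENNReal.ofReal (σ' p.2)) →
      ∃ P, L'.IsPlaque P ∧ p.2 ∈ P ∧ y ∈ P ∧ Metric.ediam P < ENNReal.ofReal (δ p))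
    (fun p a b _ hab hp => ⟨fun y hy => hp.1 y (hy.trans_le hab),
      fun y hy => hp.2 y (hy.trans_le hab)⟩) (by
      rintro a ha
      have hpa := hδpos a ha
      obtain ⟨ρ, hρ, hP⟩ := exists_common_small_plaque hσ hσpos hσs ha.1 (half_pos hpa)
      obtain ⟨ρ', hρ', hP'⟩ := exists_common_small_plaque hσ' hσpos' hσs' ha.2 (half_pos hpa)
      refine ⟨min ρ ρ', lt_min hρ hρ', ?_⟩
      filter_upwards [(hδ a ha).eventually (lt_mem_nhds (half_lt_self hpa)),
        mem_nhdsWithin_of_mem_nhds (Metric.ball_mem_nhds a (lt_min hρ hρ')),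
        self_mem_nhdsWithin] with p hp hpa hpL
      have hle := ENNReal.ofReal_le_ofReal hp.le
      have hpa₁ : dist p.1 a.1 < ρ :=
        ((le_max_left _ _).trans_lt (Metric.mem_ball.1 hpa)).trans_le (min_le_left _ _)
      have hpa₂ : dist p.2 a.2 < ρ' :=
        ((le_max_right _ _).trans_lt (Metric.mem_ball.1 hpa)).trans_le (min_le_right _ _)
      constructor
      · intro y hy hex
        obtain ⟨P, h₁, h₂, h₃, h₄⟩ := hP p.1 ⟨hpa₁, hpL.1⟩ y (hy.trans_le (min_le_left _ _)) hex
        exact ⟨P, h₁, h₂, h₃, h₄.trans_le hle⟩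
      · intro y hy hex
        obtain ⟨P, h₁, h₂, h₃, h₄⟩ := hP' p.2 ⟨hpa₂, hpL.2⟩ y (hy.trans_le (min_le_right _ _)) hex
        exact ⟨P, h₁, h₂, h₃, h₄.trans_le hle⟩)
  have hfst : MapsTo Prod.fst (L.carrier ×ˢ L'.carrier) L.carrier := fun p hp => hp.1
  have hsnd : MapsTo Prod.snd (L.carrier ×ˢ L'.carrier) L'.carrier := fun p hp => hp.2
  -- `κ` and `κ'` make the projections pseudo-orbits, the halves keep them close enough for
  -- expansiveness in the factors, and `θ` makes the resulting plaques small.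
  refine ⟨fun p => min (θ p) (min (min (κ p.1) (ε p.1 / 2)) (min (κ' p.2) (ε' p.2 / 2))),
    hθ.inf (((hκ.comp continuousOn_fst hfst).inf (hεhalf.comp continuousOn_fst hfst)).inf
      ((hκ'.comp continuousOn_snd hsnd).inf (hεhalf'.comp continuousOn_snd hsnd))),
    fun p hp => lt_min (hθpos p hp) (lt_min (lt_min (hκpos _ hp.1) (half_pos (hεpos _ hp.1)))
      (lt_min (hκpos' _ hp.2) (half_pos (hεpos' _ hp.2)))), ?_⟩
  intro η _ hη p q hp hq hpq
  simp only [lt_min_iff] at hη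
  have hx : ∀ n, dist (p n).1 (q n).1 < η (p n) := fun n => (le_max_left _ _).trans_lt (hpq n)
  have hx' : ∀ n, dist (p n).2 (q n).2 < η (p n) := fun n => (le_max_right _ _).trans_lt (hpq n)
  have hH : ∀ x ∈ L.carrier ×ˢ L'.carrier, η x ≤ κ x.1 := fun x hx => (hη x hx).2.2.1.1.le
  have hH' : ∀ x ∈ L.carrier ×ˢ L'.carrier, η x ≤ κ' x.2 := fun x hx => (hη x hx).2.2.2.1.le
  have hL : ∀ n, p n ∈ L.carrier ×ˢ L'.carrier := hp.1
  obtain ⟨P, hP, hpP, hqP, hPd⟩ := (hθP _ (hL 0)).1 (q 0).1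
    ((hx 0).trans (hη _ (hL 0)).2.1)
    (hexp _ hεhalf (fun x hx => ⟨half_pos (hεpos x hx), half_lt_self (hεpos x hx)⟩) _ _
      (IsPseudoOrbit.fst hp href hH) (IsPseudoOrbit.fst hq href hH)
      fun n => (hx n).trans (hη _ (hL n)).2.2.1.2)
  obtain ⟨P', hP', hpP', hqP', hPd'⟩ := (hθP _ (hL 0)).2 (q 0).2
    ((hx' 0).trans (hη _ (hL 0)).2.1)
    (hexp' _ hεhalf' (fun x hx => ⟨half_pos (hεpos' x hx), half_lt_self (hεpos' x hx)⟩) _ _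
      (IsPseudoOrbit.snd hp href' hH') (IsPseudoOrbit.snd hq href' hH')
      fun n => (hx' n).trans (hη _ (hL n)).2.2.2.2)
  refine ⟨P ×ˢ P', hP.prod hP', ⟨hpP, hpP'⟩, ⟨hqP, hqP'⟩, lt_of_le_of_lt ?_ (max_lt hPd hPd')⟩
  exact Metric.ediam_le fun y hy z hz => max_le_max
    (Metric.edist_le_ediam_of_mem hy.1 hz.1) (Metric.edist_le_ediam_of_mem hy.2 hz.2)

end Prod

end Lamination

/-! ## The product trellis -/

namespace LaminarStratification

variable {r : ℕ∞} {A : Type u} [MetricSpace A] {ι : Type*} {S : LaminarStratification r A ι}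
  {A' : Type v} [MetricSpace A'] {ι' : Type*} {S' : LaminarStratification r A' ι'}

/-- Closure commutes with products, and nonempty strata rule out the degenerate inclusions. -/
theorem le_prod {j k : ι} {j' k' : ι'} :
    (S.prod S').Le (j, j') (k, k') ↔ S.Le j k ∧ S'.Le j' k' := by
  change _ ×ˢ _ ⊆ closure (_ ×ˢ _) ↔ _
  rw [closure_prod_eq, prod_subset_prod_iff]
  constructor
  · rintro (h | h | h)
    · exact h
    · exact absurd h (S.nonempty j).ne_empty
    · exact absurd h (S'.nonempty j').ne_empty
  · exact Or.inl

/-- The case `k = j` is needed because a stratum of the product may differ from `(j, j')` in one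
index only. -/
theorem IsTubularNeighborhood.coherent' (hr : 1 ≤ r) {j : ι} {N : Lamination r A}
    (h : S.IsTubularNeighborhood j N) (k : ι) : N.Coherent (S.stratum k) := by
  by_cases hk : k = j
  · subst hk
    exact h.inclusion.coherent hr h.dim_eq.symm
  · exact h.coherent k hk

theorem IsTubularNeighborhood.prod (hr : 1 ≤ r) {j : ι} {j' : ι'} {N : Lamination r A}
    {N' : Lamination r A'} (h : S.IsTubularNeighborhood j N)
    (h' : S'.IsTubularNeighborhood j' N') :
    (S.prod S').IsTubularNeighborhood (j, j') (N.prod N') where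
  isOpen := h.isOpen.prod h'.isOpen
  subset := prod_mono h.subset h'.subset
  incident := by
    rintro ⟨x, x'⟩ ⟨hx, hx'⟩
    obtain ⟨k, hk, hxk⟩ := h.incident x hx
    obtain ⟨k', hk', hxk'⟩ := h'.incident x' hx'
    exact ⟨(k, k'), le_prod.2 ⟨hk, hk'⟩, hxk, hxk'⟩
  dim_eq := congrArg₂ (· + ·) h.dim_eq h'.dim_eq
  leaf_eq := by
    rintro ⟨x, x'⟩ ⟨hx, hx'⟩
    change ((S.stratum j).prod (S'.stratum j')).leaf (x, x') = _
    rw [Lamination.leaf_prod hx hx', Lamination.leaf_prod (h.subset hx) (h'.subset hx'),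
      h.leaf_eq x hx, h'.leaf_eq x' hx']
  inclusion := h.inclusion.prod h'.inclusion
  coherent := by
    rintro ⟨k, k'⟩ - ⟨x, x'⟩ ⟨hx, hxk⟩
    obtain ⟨P, Q, hP, hQ, hxP, hPQ⟩ := h.coherent' hr k x ⟨hx.1, hxk.1⟩
    obtain ⟨P', Q', hP', hQ', hxP', hPQ'⟩ := h'.coherent' hr k' x' ⟨hx.2, hxk.2⟩
    exact ⟨_, _, hP.prod hP', hQ.prod hQ', ⟨hxP, hxP'⟩, prod_mono hPQ hPQ'⟩

namespace Trellis

variable {T : S.Trellis} {T' : S'.Trellis}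

/-- The product trellis structure: its tubular neighborhoods are the products of the tubular
neighborhoods. -/
noncomputable def prod (hr : 1 ≤ r) (T : S.Trellis) (T' : S'.Trellis) : (S.prod S').Trellis where
  nhd j := (T.nhd j.1).prod (T'.nhd j.2)
  tubular j := (T.tubular j.1).prod hr (T'.tubular j.2)
  foliates j k hjk :=
    (T.foliates j.1 k.1 (le_prod.1 hjk).1).prod (T'.foliates j.2 k.2 (le_prod.1 hjk).2)

variable {f : A → A} {f' : A' → A'}

theorem IsAdapted.prod (hr : 1 ≤ r) {j : ι} {j' : ι'} {V : Set A} {V' : Set A'}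
    (h : T.IsAdapted f j V) (h' : T'.IsAdapted f' j' V') :
    (T.prod hr T').IsAdapted (Prod.map f f') (j, j') (V ×ˢ V') :=
  ⟨h.1.prod h'.1, prod_mono h.2.1 h'.2.1, prod_mono h.2.2.1 h'.2.2.1, h.2.2.2.prod h'.2.2.2⟩

theorem IsControlledEndomorphism.prod (hr : 1 ≤ r) (h : T.IsControlledEndomorphism f)
    (h' : T'.IsControlledEndomorphism f') :
    (T.prod hr T').IsControlledEndomorphism (Prod.map f f') := by
  refine ⟨h.1.prodMap h'.1, fun j => ⟨(h.2 j.1).1.prod (h'.2 j.2).1, ?_⟩⟩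
  obtain ⟨V, hV⟩ := (h.2 j.1).2
  obtain ⟨V', hV'⟩ := (h'.2 j.2).2
  exact ⟨V ×ˢ V', hV.prod hr hV'⟩

theorem IsControlledImmersion.prod (hr : 1 ≤ r) {E H M : Type*} [NormedAddCommGroup E]
    [NormedSpace ℝ E] [TopologicalSpace H] {I : ModelWithCorners ℝ E H} [TopologicalSpace M]
    [ChartedSpace H M] {E' H' M' : Type*} [NormedAddCommGroup E'] [NormedSpace ℝ E']
    [TopologicalSpace H'] {I' : ModelWithCorners ℝ E' H'} [TopologicalSpace M']
    [ChartedSpace H' M'] {i : A → M} {i' : A' → M'}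
    (h : T.IsControlledImmersion I i) (h' : T'.IsControlledImmersion I' i') :
    (T.prod hr T').IsControlledImmersion (I.prod I') (Prod.map i i') := by
  refine ⟨h.1.prodMap h'.1, fun j => ⟨(h.2 j.1).1.prod (h'.2 j.2).1, ?_⟩⟩
  obtain ⟨V, hV, hs, hn, him⟩ := (h.2 j.1).2
  obtain ⟨V', hV', hs', hn', him'⟩ := (h'.2 j.2).2
  exact ⟨V ×ˢ V', hV.prod hV', prod_mono hs hs', prod_mono hn hn', him.prod him'⟩

/-- With the minimum of the two refining functions as control, both projections are pseudo-orbits to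
which the hypotheses on the factors apply. -/
theorem PseudoOrbitsInStrata.prod (hr : 1 ≤ r) (h : T.PseudoOrbitsInStrata f)
    (h' : T'.PseudoOrbitsInStrata f') :
    (T.prod hr T').PseudoOrbitsInStrata (Prod.map f f') := by
  rintro ⟨j, j'⟩
  obtain ⟨V, hV, η, hη, hpos, horb⟩ := h j
  obtain ⟨V', hV', η', hη', hpos', horb'⟩ := h' j'
  obtain ⟨κ, hκ, hκpos, href⟩ := Lamination.exists_refinesPlaques hV.2.2.1 hη hpos
  obtain ⟨κ', hκ', hκpos', href'⟩ := Lamination.exists_refinesPlaques hV'.2.2.1 hη' hpos'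
  refine ⟨V ×ˢ V', hV.prod hr hV', fun p => min (κ p.1) (κ' p.2), ?_,
    fun p hp => lt_min (hκpos _ hp.1) (hκpos' _ hp.2), fun p hp n => ⟨?_, ?_⟩⟩
  · exact (hκ.comp continuousOn_fst fun p hp => hp.1).inf
      (hκ'.comp continuousOn_snd fun p hp => hp.2)
  · exact horb _ (Lamination.IsPseudoOrbit.fst hp href fun x _ => min_le_left _ _) n
  · exact horb' _ (Lamination.IsPseudoOrbit.snd hp href' fun x _ => min_le_right _ _) n

end Trellis

end LaminarStratification

/-! ### The product system -/

theorem mainTheorem9 {r : ℕ∞} (hr : 1 ≤ r)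
    -- the two stratified spaces and their trellis structures
    {A : Type u} [MetricSpace A] {ι : Type*} (S : LaminarStratification r A ι) (T : S.Trellis)
    {A' : Type v} [MetricSpace A'] {ι' : Type*} (S' : LaminarStratification r A' ι')
    (T' : S'.Trellis)
    -- the two manifolds
    {E H M : Type*} [NormedAddCommGroup E] [NormedSpace ℝ E] [FiniteDimensional ℝ E]
    [TopologicalSpace H] (I : ModelWithCorners ℝ E H) [I.Boundaryless]
    [TopologicalSpace M] [ChartedSpace H M] [IsManifold I ∞ M]
    {E' H' M' : Type*} [NormedAddCommGroup E'] [NormedSpace ℝ E'] [FiniteDimensional ℝ E']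
    [TopologicalSpace H'] (I' : ModelWithCorners ℝ E' H') [I'.Boundaryless]
    [TopologicalSpace M'] [ChartedSpace H' M'] [IsManifold I' ∞ M']
    -- the first system
    (f : M → M) (i : A → M) (fs : A → A) (hf : ContMDiff I I (r : WithTop ℕ∞) f)
    (hi : T.IsControlledImmersion I i) (hfs : T.IsControlledEndomorphism fs)
    (hcomm : f ∘ i = i ∘ fs) (horb : T.PseudoOrbitsInStrata fs)
    -- the second system
    (f' : M' → M') (i' : A' → M') (fs' : A' → A') (hf' : ContMDiff I' I' (r : WithTop ℕ∞) f')
    (hi' : T'.IsControlledImmersion I' i') (hfs' : T'.IsControlledEndomorphism fs')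
    (hcomm' : f' ∘ i' = i' ∘ fs') (horb' : T'.PseudoOrbitsInStrata fs') :
    (∃ Tprod : (S.prod S').Trellis,
      ContMDiff (I.prod I') (I.prod I') (r : WithTop ℕ∞) (Prod.map f f') ∧
      Tprod.IsControlledImmersion (I.prod I') (Prod.map i i') ∧
      Tprod.IsControlledEndomorphism (Prod.map fs fs') ∧
      Prod.map f f' ∘ Prod.map i i' = Prod.map i i' ∘ Prod.map fs fs' ∧
      Tprod.PseudoOrbitsInStrata (Prod.map fs fs')) ∧
    (IsEmbedding i → IsEmbedding i' →
      (∀ j, (S.stratum j).IsPlaqueExpansive fs) → (∀ j', (S'.stratum j').IsPlaqueExpansive fs') →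
      IsEmbedding (Prod.map i i') ∧
      ∀ k, ((S.prod S').stratum k).IsPlaqueExpansive (Prod.map fs fs')) := by
  refine ⟨⟨T.prod hr T', hf.prodMap hf', hi.prod hr hi', hfs.prod hr hfs', ?_,
    horb.prod hr horb'⟩, fun he he' hx hx' => ⟨he.prodMap he', fun k => (hx k.1).prod (hx' k.2)⟩⟩
  rw [Prod.map_comp_map, hcomm, hcomm', Prod.map_comp_map]
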